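/- Let $m=(m_0,m_1,\dots)$ be a sequence of integers $m_k\ge 2$ with $\sup_k m_k<\infty$, and let $G_m=\prod_{k\ge 0}\mathbb{Z}_{m_k}$ be the corresponding (bounded) Vilenkin group, with the product of the discrete topologies and with $\mu$ the product of the uniform probability measures on the groups $\mathbb{Z}_{m_k}$ (normalized Haar measure). Put $M_0=1$, $M_{k+1}=m_kM_k$, write each $n\in\mathbb{N}=\{0,1,2,\dots\}$ uniquely as $n=\sum_{k\ge 0} n_kM_k$ with $0\le n_k<m_k$, and let $$r_k(x)=\exp(2\pi i x_k/m_k),\qquad \psi_n(x)=\prod_{k\ge 0} r_k(x)^{n_k}\qquad(x\in G_m).$$ For integrable $f:G_m\to\mathbb{C}$ let $\widehat f(k)=\int_{G_m} f\,\overline{\psi_k}\,d\mu$ and $S_nf=\sum_{k=0}^{n-1}\widehat f(k)\psi_k$ (so $S_0f=0$). Let $(q_k)_{k\ge 0}$ be a sequence of non-negative real numbers with $q_0>0$, and let $$Q_n=\sum_{k=0}^{n-1}q_k,\qquad T_nf=\frac1{Q_n}\sum_{k=0}^{n-1}q_kS_kf\qquad(n\ge 1).$$ For $x\in G_m$ let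 $I_n(x)=\{y\in G_m: y_j=x_j \text{ for all } 0\le j<n\}$, and let $e_s\in G_m$ be the element whose $s$-th coordinate is $1$ and whose other coordinates are $0$. A point $x$ is a Vilenkin–Lebesgue point of an integrable function $f$ if $$W_nf(x):=\sum_{s=0}^{n-1}M_s\sum_{r=1}^{m_s-1}\int_{I_n(x-re_s)}|f(t)-f(x)|\,d\mu(t)\longrightarrow 0\qquad (n\to\infty).$$ Suppose that one of the following holds: (a) $(q_k)$ is non-increasing and $Q_n\to\infty$; (b) $(q_k)$ is non-decreasing and $q_{n-1}/Q_n=O(1/n)$ as $n\to\infty$. Then: 1. for every $1\le p<\infty$ and every $f\in L_p(G_m)$, $\|T_nf-f\|_p\to 0$ as $n\to\infty$; 2. for every $f\in L_1(G_m)$ and every point $x$ at which $f$ is continuous, $T_nf(x)\to f(x)$ as $n\to\infty$; 3. for every $1\le p<\infty$, every $f\in L_p(G_m)$ and every Vilenkin–Lebesgue point $x$ of $f$, $T_nf(x)\to f(x)$ as $n\to\infty$. -/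

import Mathlib

open MeasureTheory Filter Topology
open scoped ENNReal ComplexConjugate

noncomputable section

namespace Vilenkin

/-- The Vilenkin group `G_m`: the complete direct product of the cyclic groups `Z_{m_k}`, with the
product of the discrete topologies and the product sigma-algebra. -/
abbrev Group (m : ℕ → ℕ) : Type := ∀ k, ZMod (m k)

/-- The normalized Haar measure of `G_m`: the direct product of the uniform probability measures
`μ_k({j}) = 1 / m_k`. -/
def haar (m : ℕ → ℕ) [∀ k, NeZero (m k)] : Measure (Group m) :=
  Measure.infinitePi fun k => (PMF.uniformOfFintype (ZMod (m k))).toMeasure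

/-- The basic neighbourhood `I_n(x) = {y | y_0 = x_0, …, y_{n-1} = x_{n-1}}`. -/
def cyl (m : ℕ → ℕ) (n : ℕ) (x : Group m) : Set (Group m) :=
  {y | ∀ k < n, y k = x k}

/-- The generalized number system: `M_0 = 1`, `M_{k+1} = m_k M_k`. -/
def bigM (m : ℕ → ℕ) : ℕ → ℕ
  | 0 => 1
  | k + 1 => m k * bigM m k

/-- The digit `n_k` of `n` in the expansion `n = ∑ n_k M_k`, `0 ≤ n_k < m_k`. -/
def digit (m : ℕ → ℕ) (n k : ℕ) : ℕ := n / bigM m k % m k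

/-- The generalized Rademacher function `r_k(x) = exp(2πi x_k / m_k)`. -/
def rademacher (m : ℕ → ℕ) (k : ℕ) (x : Group m) : ℂ :=
  Complex.exp (2 * Real.pi * Complex.I * ((x k).val : ℂ) / (m k : ℂ))

/-- The Vilenkin function `ψ_n = ∏_k r_k ^ n_k`; for `m_k ≥ 2` only finitely many factors have a
nonzero exponent. -/
def psi (m : ℕ → ℕ) (n : ℕ) (x : Group m) : ℂ :=
  ∏ᶠ k : ℕ, rademacher m k x ^ digit m n k

variable (m : ℕ → ℕ) [∀ k, NeZero (m k)]

/-- The Vilenkin–Fourier coefficient `∫ f conj(ψ_n) dμ`. -/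
def fourierCoeff (f : Group m → ℂ) (n : ℕ) : ℂ :=
  ∫ t, f t * conj (psi m n t) ∂(haar m)

/-- The partial sum `S_n f = ∑_{k < n} f̂(k) ψ_k`; in particular `S_0 f = 0`. -/
def partialSum (n : ℕ) (f : Group m → ℂ) (x : Group m) : ℂ :=
  ∑ k ∈ Finset.range n, fourierCoeff m f k * psi m k x

/-- `Q_n = ∑_{k < n} q_k`. -/
def bigQ (q : ℕ → ℝ) (n : ℕ) : ℝ := ∑ k ∈ Finset.range n, q k

/-- The `T` mean `T_n f = (1 / Q_n) ∑_{k < n} q_k S_k f`. -/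
def tMean (q : ℕ → ℝ) (n : ℕ) (f : Group m → ℂ) (x : Group m) : ℂ :=
  (1 / (bigQ q n : ℂ)) * ∑ k ∈ Finset.range n, (q k : ℂ) * partialSum m k f x

/-- The operator
`W_n f(x) = ∑_{s < n} M_s ∑_{r = 1}^{m_s - 1} ∫_{I_n(x - r e_s)} |f(t) - f(x)| dμ(t)`, where `e_s`
has `s`-th coordinate `1` and all other coordinates `0`. -/
def W (n : ℕ) (f : Group m → ℂ) (x : Group m) : ℝ :=
  ∑ s ∈ Finset.range n, (bigM m s : ℝ) * ∑ r ∈ Finset.Ico 1 (m s),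
    ∫ t in cyl m n (x - Pi.single s (r : ZMod (m s))), ‖f t - f x‖ ∂(haar m)

/-- `x` is a Vilenkin–Lebesgue point of the integrable function `f`. -/
def IsVilenkinLebesguePoint (f : Group m → ℂ) (x : Group m) : Prop :=
  Integrable f (haar m) ∧ Tendsto (fun n => W m n f x) atTop (𝓝 0)

end Vilenkin

end

/-!
With `D_n = ∑_{k < n} ψ_k` and `L_n = ∑_{k < n} D_k`, the sum `∑_{k < n} S_k f` is the integral of `f`
against `L_n(x - t)`. Summation by parts writes `T_n f` as a combination of the Fejér means
`(1/n) ∑_{k < n} S_k f`. Under either monotonicity hypothesis the absolute values of its weights have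
bounded sums and each individual weight tends to zero, so the Silverman–Toeplitz theorem
(`tendsto_sum_mul_zero`, `tendsto_weighted_mean_zero`) reduces all three claims to the Fejér means. It
is applied in `ℂ` for the pointwise claims and in the Banach space `L_p` for norm convergence.

The Fejér kernel is controlled pointwise. From `ψ_{a M_s + i} = r_s^a ψ_i` one gets recursions for
`D_{a M_s + b}` and `L_{a M_s + b}`. As `∑_{i < m_s} r_s^i` vanishes off `{x_s = 0}`, they give
`|L_n| ≤ C ∑_{M_s ≤ n} M_s R_s`, where
`R_s = M_s 1_{I_s} + ∑_{j < s} M_j ∑_{0 ≤ r < m_j} 1_{r e_j + I_s}` (`norm_fejer_le`); this is where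
boundedness of `m` is needed.

Integrating `|f(t) - f(x)|` against `R_s(x - t)` produces `W_s f(x)` and the cylinder mean
`M_s ∫_{I_s(x)} |f - f(x)|`. At a Vilenkin–Lebesgue point the latter also tends to zero, because
splitting `I_s(x)` by its next coordinate bounds it by a geometric series of `W_i f(x)`, `i > s`. The
factors `M_s / M_N` then form another Toeplitz matrix, and the Fejér means converge. A point of
continuity is a Vilenkin–Lebesgue point.

For `L_p`, the same bound shows that the kernels `L_n / n` have bounded `L_1` norms, so by Schur's
test the Fejér means are uniformly bounded on `L_p`. They converge boundedly and pointwise for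
continuous functions, and these are dense.
-/

noncomputable section

namespace Vilenkin

/-! ### Summability methods -/

/-- **Silverman–Toeplitz**, for null sequences and non-negative weights. -/
lemma tendsto_sum_mul_zero {a : ℕ → ℕ → ℝ} {c : ℕ → ℝ} {C : ℝ} {s : ℕ → Finset ℕ}
    (ha : ∀ n k, 0 ≤ a n k) (hC : ∀ᶠ n in atTop, ∑ k ∈ s n, a n k ≤ C)
    (h0 : ∀ k, Tendsto (fun n => a n k) atTop (𝓝 0)) (hc : Tendsto c atTop (𝓝 0)) :
    Tendsto (fun n => ∑ k ∈ s n, a n k * c k) atTop (𝓝 0) := by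
  rw [Metric.tendsto_atTop]
  intro ε hε
  have hδ : 0 < ε / (2 * (|C| + 1)) := by positivity
  obtain ⟨K, hK⟩ := Metric.tendsto_atTop.1 hc _ hδ
  -- Beyond `K` the sequence is small; the finitely many columns before `K` tend to zero.
  have hhead : Tendsto (fun n => ∑ k ∈ Finset.range K, a n k * |c k|) atTop (𝓝 0) := by
    simpa using tendsto_finsetSum (Finset.range K) fun k _ => (h0 k).mul_const |c k|
  rw [← eventually_atTop]
  filter_upwards [hC, hhead.eventually_lt_const (half_pos hε)] with n hn hn'
  rw [Real.dist_eq, sub_zero]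
  calc |∑ k ∈ s n, a n k * c k|
      ≤ ∑ k ∈ s n, a n k * |c k| := by
        refine (Finset.abs_sum_le_sum_abs _ _).trans (Finset.sum_le_sum fun k _ => ?_)
        rw [abs_mul, abs_of_nonneg (ha n k)]
    _ ≤ ∑ k ∈ s n, ((if k < K then a n k * |c k| else 0) + a n k * (ε / (2 * (|C| + 1)))) := by
        refine Finset.sum_le_sum fun k _ => ?_
        split_ifs with hk
        · have := mul_nonneg (ha n k) hδ.le
          linarith
        · rw [zero_add]
          have := hK k (not_lt.1 hk)
          rw [Real.dist_eq, sub_zero] at this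
          exact mul_le_mul_of_nonneg_left this.le (ha n k)
    _ ≤ ∑ k ∈ Finset.range K, a n k * |c k| + C * (ε / (2 * (|C| + 1))) := by
        rw [Finset.sum_add_distrib, ← Finset.sum_mul, ← Finset.sum_filter]
        refine add_le_add ?_ (mul_le_mul_of_nonneg_right hn hδ.le)
        refine Finset.sum_le_sum_of_subset_of_nonneg (fun k hk => ?_) fun k _ _ =>
          mul_nonneg (ha n k) (abs_nonneg _)
        simpa using (Finset.mem_filter.1 hk).2
    _ < ε := by
        have : C * (ε / (2 * (|C| + 1))) ≤ ε / 2 := by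
          rw [mul_div_assoc', div_le_div_iff₀ (by positivity) two_pos]
          nlinarith [le_abs_self C]
        linarith

/-- The two monotonicity hypotheses on `q` enter only through this: `Q_n → ∞`, and the weights that
summation by parts puts on the Cesàro means are `O(Q_n)` in total. -/
lemma weights_bound {q : ℕ → ℝ} (hq : ∀ k, 0 ≤ q k) (hq0 : 0 < q 0)
    (hmono : (Antitone q ∧ Tendsto (bigQ q) atTop atTop) ∨
      (Monotone q ∧
        (fun n : ℕ => q (n - 1) / bigQ q n) =O[atTop] (fun n : ℕ => 1 / (n : ℝ)))) :
    Tendsto (bigQ q) atTop atTop ∧ ∃ C : ℝ, ∀ᶠ n : ℕ in atTop, q (n - 1) * n ≤ C * bigQ q n ∧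
      ∑ k ∈ Finset.range (n - 1), |q (k + 1) - q k| * ((k : ℝ) + 1) ≤ C * bigQ q n := by
  -- Summation by parts against the constant sequence `1`. The differences of `q` have constant sign,
  -- so this evaluates the sum of their absolute values.
  have abel (n : ℕ) : bigQ q n = q (n - 1) * n -
      ∑ k ∈ Finset.range (n - 1), (q (k + 1) - q k) * ((k : ℝ) + 1) := by
    simpa [bigQ] using Finset.sum_range_by_parts q (fun _ => (1 : ℝ)) n
  rcases hmono with ⟨hanti, hQ⟩ | ⟨hmon, hO⟩
  · refine ⟨hQ, 1, Eventually.of_forall fun n => ?_⟩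
    have h1 : ∑ k ∈ Finset.range (n - 1), |q (k + 1) - q k| * ((k : ℝ) + 1) =
        -∑ k ∈ Finset.range (n - 1), (q (k + 1) - q k) * ((k : ℝ) + 1) := by
      rw [← Finset.sum_neg_distrib]
      refine Finset.sum_congr rfl fun k _ => ?_
      rw [abs_of_nonpos (sub_nonpos.2 (hanti k.le_succ)), neg_mul]
    have h2 : 0 ≤ ∑ k ∈ Finset.range (n - 1), |q (k + 1) - q k| * ((k : ℝ) + 1) := by positivity
    have h3 : 0 ≤ q (n - 1) * n := mul_nonneg (hq _) n.cast_nonneg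
    have := abel n
    constructor <;> linarith
  · have hQ (n : ℕ) : n * q 0 ≤ bigQ q n := by
      have := Finset.card_nsmul_le_sum (Finset.range n) q (q 0) fun k _ => hmon k.zero_le
      simpa [bigQ] using this
    refine ⟨tendsto_atTop_mono hQ (tendsto_natCast_atTop_atTop.atTop_mul_const hq0), ?_⟩
    obtain ⟨C, hC⟩ := hO.bound
    refine ⟨C, ?_⟩
    filter_upwards [hC, eventually_gt_atTop 0] with n hn hn0
    have hn0' : (0 : ℝ) < n := by exact_mod_cast hn0
    have hQn : 0 < bigQ q n := (mul_pos hn0' hq0).trans_le (hQ n)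
    have h1 : q (n - 1) * n ≤ C * bigQ q n := by
      rw [Real.norm_of_nonneg (div_nonneg (hq _) hQn.le), Real.norm_of_nonneg (by positivity),
        mul_one_div, div_le_div_iff₀ hQn hn0'] at hn
      exact hn
    refine ⟨h1, ?_⟩
    have h2 : ∑ k ∈ Finset.range (n - 1), |q (k + 1) - q k| * ((k : ℝ) + 1) =
        ∑ k ∈ Finset.range (n - 1), (q (k + 1) - q k) * ((k : ℝ) + 1) := by
      refine Finset.sum_congr rfl fun k _ => ?_
      rw [abs_of_nonneg (sub_nonneg.2 (hmon k.le_succ))]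
    have := abel n
    linarith

/-- The `T` method is at least as strong as the Cesàro method. -/
lemma tendsto_weighted_mean_zero {E : Type*} [NormedAddCommGroup E] [NormedSpace ℝ E]
    {q : ℕ → ℝ} (hq : ∀ k, 0 ≤ q k) (hq0 : 0 < q 0)
    (hmono : (Antitone q ∧ Tendsto (bigQ q) atTop atTop) ∨
      (Monotone q ∧
        (fun n : ℕ => q (n - 1) / bigQ q n) =O[atTop] (fun n : ℕ => 1 / (n : ℝ))))
    {u : ℕ → E}
    (hu : Tendsto (fun n : ℕ => (n : ℝ)⁻¹ • ∑ k ∈ Finset.range n, u k) atTop (𝓝 0)) :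
    Tendsto (fun n : ℕ => (bigQ q n)⁻¹ • ∑ k ∈ Finset.range n, q k • u k) atTop (𝓝 0) := by
  obtain ⟨hQ, C, hC⟩ := weights_bound hq hq0 hmono
  set c : ℕ → ℝ := fun n => ‖(n : ℝ)⁻¹ • ∑ k ∈ Finset.range n, u k‖ with hc
  have hc0 : Tendsto c atTop (𝓝 0) := by simpa using hu.norm
  have hB (n : ℕ) : ‖∑ k ∈ Finset.range n, u k‖ = n * c n := by
    rcases Nat.eq_zero_or_pos n with rfl | hn
    · simp
    · have : (0 : ℝ) < n := by exact_mod_cast hn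
      simp only [hc]
      rw [norm_smul, norm_inv, Real.norm_of_nonneg this.le, mul_inv_cancel_left₀ this.ne']
  have hQ0 (n : ℕ) : 0 ≤ bigQ q n := Finset.sum_nonneg fun k _ => hq k
  have hsum : Tendsto (fun n => ∑ k ∈ Finset.range (n - 1),
      (|q (k + 1) - q k| * ((k : ℝ) + 1) / bigQ q n) * c (k + 1)) atTop (𝓝 0) := by
    refine tendsto_sum_mul_zero (C := C) (fun n k => div_nonneg (by positivity) (hQ0 n)) ?_
      (fun k => hQ.const_div_atTop _) ((tendsto_add_atTop_iff_nat 1).2 hc0)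
    filter_upwards [hC, hQ.eventually_gt_atTop 0] with n hn hn0
    rw [← Finset.sum_div, div_le_iff₀ hn0]
    exact hn.2
  have hlast : Tendsto (fun n => C * c n) atTop (𝓝 0) := by simpa using hc0.const_mul C
  refine squeeze_zero_norm' ?_ (by simpa using hlast.add hsum)
  filter_upwards [hC, hQ.eventually_gt_atTop 0] with n hn hn0
  rw [Finset.sum_range_by_parts, norm_smul, norm_inv, Real.norm_of_nonneg hn0.le,
    inv_mul_le_iff₀ hn0]
  refine (norm_sub_le _ _).trans ?_
  rw [mul_add]
  refine add_le_add ?_ ((norm_sum_le _ _).trans ?_)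
  · rw [norm_smul, hB, Real.norm_of_nonneg (hq _), ← mul_assoc, ← mul_assoc, mul_comm _ C]
    exact mul_le_mul_of_nonneg_right hn.1 (norm_nonneg _)
  · rw [Finset.mul_sum]
    refine Finset.sum_le_sum fun k _ => le_of_eq ?_
    rw [norm_smul, hB, Real.norm_eq_abs]
    push_cast
    field_simp

/-! ### The generalized number system -/

variable {m : ℕ → ℕ}

lemma bigM_dvd_bigM (m : ℕ → ℕ) {k n : ℕ} (h : k ≤ n) : bigM m k ∣ bigM m n := by
  induction n, h using Nat.le_induction with
  | base => exact dvd_rfl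
  | succ n _ ih => exact ih.mul_left _

lemma two_mul_bigM_le (hm : ∀ k, 2 ≤ m k) (n : ℕ) : 2 * bigM m n ≤ bigM m (n + 1) :=
  Nat.mul_le_mul_right _ (hm n)

lemma two_pow_le_bigM (hm : ∀ k, 2 ≤ m k) (n : ℕ) : 2 ^ n ≤ bigM m n := by
  induction n with
  | zero => exact le_rfl
  | succ n ih =>
    have := two_mul_bigM_le hm n
    rw [pow_succ]
    omega

lemma sum_bigM_le (hm : ∀ k, 2 ≤ m k) (n : ℕ) : ∑ s ∈ Finset.range n, bigM m s ≤ bigM m n := by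
  induction n with
  | zero => simp
  | succ n ih =>
    have := two_mul_bigM_le hm n
    rw [Finset.sum_range_succ]
    omega

lemma tendsto_bigM_atTop (hm : ∀ k, 2 ≤ m k) : Tendsto (fun n => (bigM m n : ℝ)) atTop atTop :=
  tendsto_natCast_atTop_atTop.comp
    (tendsto_atTop_mono (two_pow_le_bigM hm) (tendsto_pow_atTop_atTop_of_one_lt one_lt_two))

lemma digit_eq_zero {n k : ℕ} (h : n < bigM m k) : digit m n k = 0 := by
  rw [digit, Nat.div_eq_of_lt h, Nat.zero_mod]

variable [∀ k, NeZero (m k)]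

lemma bigM_pos (m : ℕ → ℕ) [∀ k, NeZero (m k)] (n : ℕ) : 0 < bigM m n := by
  induction n with
  | zero => exact Nat.one_pos
  | succ n ih => exact Nat.mul_pos (Nat.pos_of_ne_zero (NeZero.ne _)) ih

/-- Every `n ≥ M_K` lies in a block `[M_N, M_{N+1})` with `N ≥ K`. -/
lemma exists_bigM_le_lt (hm : ∀ k, 2 ≤ m k) {n K : ℕ} (hn : bigM m K ≤ n) :
    ∃ N, K ≤ N ∧ bigM m N ≤ n ∧ n < bigM m (N + 1) := by
  have hex : ∃ N, n < bigM m N := ⟨n, Nat.lt_two_pow_self.trans_le (two_pow_le_bigM hm n)⟩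
  classical
  have hspec := Nat.find_spec hex
  have hK : K < Nat.find hex := by
    by_contra! h
    exact absurd (Nat.le_of_dvd (bigM_pos m K) (bigM_dvd_bigM m h)) (by omega)
  refine ⟨Nat.find hex - 1, by omega, not_lt.1 (Nat.find_min hex (by omega)), ?_⟩
  rwa [Nat.sub_add_cancel (by omega)]

/-- The digits of `a M_s + i`, for `a < m_s` and `i < M_s`, are those of `i` together with the digit
`a` in position `s`. -/
lemma digit_mul_add {s a i : ℕ} (ha : a < m s) (hi : i < bigM m s) (k : ℕ) :
    digit m (a * bigM m s + i) k = digit m i k + if k = s then a else 0 := by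
  unfold digit
  rcases lt_trichotomy k s with hk | rfl | hk
  · obtain ⟨d, hd⟩ := bigM_dvd_bigM m (Nat.succ_le_of_lt hk)
    have h : a * bigM m s = bigM m k * (m k * (a * d)) := by
      rw [hd, bigM]
      ring
    rw [h, Nat.mul_add_div (bigM_pos m k), Nat.mul_add_mod, if_neg hk.ne, add_zero]
  · rw [add_comm, Nat.add_mul_div_right _ _ (bigM_pos m k), Nat.div_eq_of_lt hi, if_pos rfl,
      zero_add, Nat.zero_mod, zero_add, Nat.mod_eq_of_lt ha]
  · have hle : bigM m (s + 1) ≤ bigM m k :=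
      Nat.le_of_dvd (bigM_pos m k) (bigM_dvd_bigM m hk)
    have h1 : a * bigM m s + i < bigM m (s + 1) := by
      have : (a + 1) * bigM m s ≤ m s * bigM m s := Nat.mul_le_mul_right _ ha
      rw [bigM]
      linarith
    rw [Nat.div_eq_of_lt (h1.trans_le hle), Nat.div_eq_of_lt (by
      have := Nat.le_of_dvd (bigM_pos m _) (bigM_dvd_bigM m (s.le_succ.trans hk)); omega), if_neg hk.ne', add_zero]

/-- Non-negative averages with weights `M_s / M_N` preserve null sequences. -/
lemma tendsto_bigM_mean_zero (hm : ∀ k, 2 ≤ m k) {c : ℕ → ℝ} (hc : Tendsto c atTop (𝓝 0)) :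
    Tendsto (fun N => ∑ s ∈ Finset.range (N + 1), ((bigM m s : ℝ) / bigM m N) * c s)
      atTop (𝓝 0) := by
  refine tendsto_sum_mul_zero (C := 2) (fun N s => by positivity) (Eventually.of_forall fun N => ?_)
    (fun s => (tendsto_bigM_atTop hm).const_div_atTop _) hc
  have hpos : (0 : ℝ) < bigM m N := by exact_mod_cast bigM_pos m N
  rw [← Finset.sum_div, div_le_iff₀ hpos, Finset.sum_range_succ]
  have : (∑ s ∈ Finset.range N, (bigM m s : ℝ)) ≤ bigM m N := by exact_mod_cast sum_bigM_le hm N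
  linarith

/-! ### Vilenkin functions as characters -/

lemma rademacher_eq_stdAddChar (k : ℕ) (x : Group m) :
    rademacher m k x = ZMod.stdAddChar (x k) := by
  have h := ZMod.stdAddChar_coe (N := m k) ((x k).val : ℤ)
  rw [Int.cast_natCast, ZMod.natCast_rightInverse (x k)] at h
  rw [h, rademacher]
  push_cast
  rfl

lemma norm_rademacher (k : ℕ) (x : Group m) : ‖rademacher m k x‖ = 1 := by
  rw [rademacher_eq_stdAddChar]
  exact AddChar.norm_apply _ _

lemma rademacher_add (k : ℕ) (x y : Group m) :
    rademacher m k (x + y) = rademacher m k x * rademacher m k y := by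
  simp only [rademacher_eq_stdAddChar, Pi.add_apply, AddChar.map_add_eq_mul]

lemma rademacher_eq_one_iff (k : ℕ) (x : Group m) : rademacher m k x = 1 ↔ x k = 0 := by
  rw [rademacher_eq_stdAddChar, ← ZMod.injective_stdAddChar.eq_iff, AddChar.map_zero_eq_one]

lemma rademacher_pow_card (k : ℕ) (x : Group m) : rademacher m k x ^ m k = 1 := by
  rw [rademacher_eq_stdAddChar, ← AddChar.map_nsmul_eq_pow, nsmul_eq_mul, ZMod.natCast_self,
    zero_mul, AddChar.map_zero_eq_one]

lemma sum_rademacher_pow_eq_zero {k : ℕ} {x : Group m} (h : x k ≠ 0) :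
    ∑ i ∈ Finset.range (m k), rademacher m k x ^ i = 0 := by
  rw [geom_sum_eq (mt (rademacher_eq_one_iff k x).1 h), rademacher_pow_card, sub_self, zero_div]

lemma norm_sum_rademacher_pow_le (k a : ℕ) (x : Group m) :
    ‖∑ i ∈ Finset.range a, rademacher m k x ^ i‖ ≤ a := by
  refine (norm_sum_le _ _).trans ?_
  simp [norm_rademacher]

lemma psi_eq_prod {n N : ℕ} (h : n < bigM m N) (x : Group m) :
    psi m n x = ∏ k ∈ Finset.range N, rademacher m k x ^ digit m n k := by
  refine finprod_eq_prod_of_mulSupport_subset _ fun k hk => ?_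
  rw [Finset.coe_range, Set.mem_Iio]
  by_contra! hN
  refine hk ?_
  simp only
  rw [digit_eq_zero (h.trans_le (Nat.le_of_dvd (bigM_pos m k) (bigM_dvd_bigM m hN))), pow_zero]

lemma psi_zero (x : Group m) : psi m 0 x = 1 := by
  simpa using psi_eq_prod (m := m) (bigM_pos m 0) x

lemma psi_mul_add {s a i : ℕ} (ha : a < m s) (hi : i < bigM m s) (x : Group m) :
    psi m (a * bigM m s + i) x = rademacher m s x ^ a * psi m i x := by
  have h1 : a * bigM m s + i < bigM m (s + 1) := by
    have : (a + 1) * bigM m s ≤ m s * bigM m s := Nat.mul_le_mul_right _ ha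
    rw [bigM]
    linarith
  have h2 : i < bigM m (s + 1) :=
    hi.trans_le (Nat.le_of_dvd (bigM_pos m _) (bigM_dvd_bigM m s.le_succ))
  simp only [psi_eq_prod h1, psi_eq_prod h2, digit_mul_add ha hi, pow_add, Finset.prod_mul_distrib]
  rw [mul_comm]
  congr 1
  rw [Finset.prod_eq_single s (fun k _ hk => by simp [hk]) (fun h => by simp at h), if_pos rfl]

lemma psi_add (hm : ∀ k, 2 ≤ m k) (n : ℕ) (x y : Group m) :
    psi m n (x + y) = psi m n x * psi m n y := by
  have h : n < bigM m n := Nat.lt_two_pow_self.trans_le (two_pow_le_bigM hm n)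
  simp only [psi_eq_prod h, rademacher_add, mul_pow, Finset.prod_mul_distrib]

lemma norm_psi (hm : ∀ k, 2 ≤ m k) (n : ℕ) (x : Group m) : ‖psi m n x‖ = 1 := by
  have h : n < bigM m n := Nat.lt_two_pow_self.trans_le (two_pow_le_bigM hm n)
  simp [psi_eq_prod h, norm_rademacher]

lemma psi_sub (hm : ∀ k, 2 ≤ m k) (n : ℕ) (x t : Group m) :
    psi m n (x - t) = psi m n x * conj (psi m n t) := by
  have h := psi_add hm n (x - t) t
  rw [sub_add_cancel] at h
  rw [h, mul_assoc, Complex.mul_conj, Complex.normSq_eq_norm_sq, norm_psi hm]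
  simp

/-- A Vilenkin function of positive index is a nontrivial character. -/
lemma exists_psi_ne_one (hm : ∀ k, 2 ≤ m k) {n : ℕ} (hn : n ≠ 0) : ∃ c : Group m, psi m n c ≠ 1 := by
  obtain ⟨N, -, h1, h2⟩ := exists_bigM_le_lt hm (n := n) (K := 0) (Nat.one_le_iff_ne_zero.2 hn)
  refine ⟨Pi.single N 1, ?_⟩
  have ha : n / bigM m N < m N := Nat.div_lt_of_lt_mul (by rwa [mul_comm])
  have ha0 : 0 < n / bigM m N := Nat.div_pos h1 (bigM_pos m N)
  rw [psi_eq_prod h2, Finset.prod_eq_single N]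
  · rw [digit, Nat.mod_eq_of_lt ha, rademacher_eq_stdAddChar, Pi.single_eq_same,
      ← AddChar.map_nsmul_eq_pow, nsmul_one, Ne, ← AddChar.map_zero_eq_one (ZMod.stdAddChar (N := m N)),
      ZMod.injective_stdAddChar.eq_iff, ZMod.natCast_eq_zero_iff]
    exact Nat.not_dvd_of_pos_of_lt ha0 ha
  · intro k _ hk
    rw [(rademacher_eq_one_iff k _).2 (Pi.single_eq_of_ne hk _), one_pow]
  · simp

/-! ### Pointwise bounds for the kernels -/

/-- The Dirichlet kernel `D_n = ∑_{k < n} ψ_k`. -/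
def dirichlet (m : ℕ → ℕ) (n : ℕ) (x : Group m) : ℂ := ∑ k ∈ Finset.range n, psi m k x

/-- The unnormalized Fejér kernel `L_n = ∑_{k < n} D_k`. -/
def fejer (m : ℕ → ℕ) (n : ℕ) (x : Group m) : ℂ := ∑ k ∈ Finset.range n, dirichlet m k x

/-- The points whose coordinates of index below `s` all vanish, except possibly the `j`-th: the
union of the cosets `r e_j + I_s`, `0 ≤ r < m_j`. -/
def spike (m : ℕ → ℕ) (j s : ℕ) : Set (Group m) := {x | ∀ k < s, k ≠ j → x k = 0}

/-- The function `R_s = M_s 1_{I_s} + ∑_{j < s} M_j 1_{spike j s}`, which dominates the block of the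
Fejér kernel at scale `s`. -/
def majorant (m : ℕ → ℕ) [∀ k, NeZero (m k)] (s : ℕ) (x : Group m) : ℝ :=
  bigM m s * (cyl m s 0).indicator 1 x +
    ∑ j ∈ Finset.range s, (bigM m j : ℝ) * (spike m j s).indicator 1 x

lemma dirichlet_mul_add {s a j : ℕ} (ha : a < m s) (hj : j ≤ bigM m s) (x : Group m) :
    dirichlet m (a * bigM m s + j) x =
      dirichlet m (a * bigM m s) x + rademacher m s x ^ a * dirichlet m j x := by
  simp only [dirichlet]
  rw [Finset.sum_range_add, Finset.mul_sum]
  congr 1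
  exact Finset.sum_congr rfl fun i hi =>
    psi_mul_add ha ((Finset.mem_range.1 hi).trans_le hj) x

lemma dirichlet_mul {s a : ℕ} (ha : a ≤ m s) (x : Group m) :
    dirichlet m (a * bigM m s) x =
      (∑ l ∈ Finset.range a, rademacher m s x ^ l) * dirichlet m (bigM m s) x := by
  induction a with
  | zero => simp [dirichlet]
  | succ a ih =>
    rw [add_mul, one_mul, dirichlet_mul_add ha le_rfl, ih (by omega), Finset.sum_range_succ, add_mul]

lemma fejer_mul_add {s a b : ℕ} (ha : a < m s) (hb : b ≤ bigM m s) (x : Group m) :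
    fejer m (a * bigM m s + b) x = fejer m (a * bigM m s) x +
      b * (∑ l ∈ Finset.range a, rademacher m s x ^ l) * dirichlet m (bigM m s) x +
      rademacher m s x ^ a * fejer m b x := by
  simp only [fejer]
  rw [Finset.sum_range_add, Finset.sum_congr rfl fun i hi =>
    dirichlet_mul_add ha ((Finset.mem_range.1 hi).le.trans hb) x, Finset.sum_add_distrib,
    Finset.sum_const, Finset.card_range, nsmul_eq_mul, ← Finset.mul_sum, dirichlet_mul ha.le]
  ring

lemma fejer_mul {s a : ℕ} (ha : a ≤ m s) (x : Group m) :
    fejer m (a * bigM m s) x =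
      bigM m s * (∑ i ∈ Finset.range a, ∑ l ∈ Finset.range i, rademacher m s x ^ l) *
        dirichlet m (bigM m s) x +
      (∑ l ∈ Finset.range a, rademacher m s x ^ l) * fejer m (bigM m s) x := by
  induction a with
  | zero => simp [fejer]
  | succ a ih =>
    rw [add_mul, one_mul, fejer_mul_add ha le_rfl, ih (by omega), Finset.sum_range_succ,
      Finset.sum_range_succ]
    ring

lemma norm_dirichlet_le (hm : ∀ k, 2 ≤ m k) (n : ℕ) (x : Group m) : ‖dirichlet m n x‖ ≤ n := by
  refine (norm_sum_le _ _).trans ?_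
  simp [norm_psi hm]

lemma norm_dirichlet_bigM_le (hm : ∀ k, 2 ≤ m k) (s : ℕ) (x : Group m) :
    ‖dirichlet m (bigM m s) x‖ ≤ bigM m s * (cyl m s 0).indicator 1 x := by
  by_cases hx : x ∈ cyl m s 0
  · simpa [Set.indicator_of_mem hx] using norm_dirichlet_le hm (bigM m s) x
  · rw [Set.indicator_of_notMem hx, mul_zero, norm_le_zero_iff]
    induction s with
    | zero => exact absurd (fun k hk => absurd hk k.not_lt_zero) hx
    | succ s ih =>
      rw [bigM, dirichlet_mul le_rfl]
      by_cases hs : x s = 0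
      · rw [ih fun h => hx fun k hk => ?_, mul_zero]
        rcases (Nat.lt_succ_iff_lt_or_eq.1 hk) with hk | rfl
        exacts [h k hk, hs]
      · rw [sum_rademacher_pow_eq_zero hs, zero_mul]

lemma norm_sum_sum_rademacher_pow_le (k a : ℕ) (x : Group m) :
    ‖∑ i ∈ Finset.range a, ∑ l ∈ Finset.range i, rademacher m k x ^ l‖ ≤ (a : ℝ) * a := by
  refine (norm_sum_le_of_le (n := fun _ => (a : ℝ)) _ fun i hi => ?_).trans (by simp)
  refine (norm_sum_rademacher_pow_le k i x).trans ?_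
  exact_mod_cast (Finset.mem_range.1 hi).le

/-- The factor `∑_{i < m_s} r_s^i` vanishes unless `x_s = 0`; hence in passing from `M_s` to
`M_{s+1}` the old cosets shrink, and only the new coset family of `e_s` appears. -/
lemma norm_fejer_bigM_le (hm : ∀ k, 2 ≤ m k) {lam : ℕ} (hlam : ∀ k, m k ≤ lam) (s : ℕ)
    (x : Group m) : ‖fejer m (bigM m s) x‖ ≤
      lam * bigM m s * ∑ j ∈ Finset.range s, (bigM m j : ℝ) * (spike m j s).indicator 1 x := by
  induction s with
  | zero => simp [fejer, bigM, dirichlet]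
  | succ s ih =>
    have hlam' : (m s : ℝ) ≤ lam := by exact_mod_cast hlam s
    -- The term `j = s` of the majorant at level `s + 1` is supported on all of `I_s`.
    have hcyl : cyl m s 0 = spike m s (s + 1) := by
      ext y
      refine ⟨fun h k hk hks => h k (by omega), fun h k hk => h k (by omega) (by omega)⟩
    have hM : bigM m (s + 1) = m s * bigM m s := rfl
    rw [Finset.sum_range_succ, mul_add, ← hcyl, hM, fejer_mul le_rfl]
    refine ((norm_add_le _ _).trans_eq (add_comm _ _)).trans (add_le_add ?_ ?_)
    · rw [norm_mul]
      by_cases hs : x s = 0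
      · refine (mul_le_mul (norm_sum_rademacher_pow_le s _ x) ih (norm_nonneg _)
          (Nat.cast_nonneg _)).trans (le_of_eq ?_)
        have hind (j : ℕ) : (spike m j (s + 1)).indicator (1 : Group m → ℝ) x =
            (spike m j s).indicator 1 x := by
          have : x ∈ spike m j (s + 1) ↔ x ∈ spike m j s := by
            refine ⟨fun h k hk => h k (by omega), fun h k hk hkj => ?_⟩
            rcases (Nat.lt_succ_iff_lt_or_eq.1 hk) with hk | rfl
            exacts [h k hk hkj, hs]
          classical simp only [Set.indicator_apply, this]
        simp only [hind]
        push_cast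
        ring
      · rw [sum_rademacher_pow_eq_zero hs, norm_zero, zero_mul]
        exact mul_nonneg (by positivity) (Finset.sum_nonneg fun _ _ =>
          mul_nonneg (Nat.cast_nonneg _) (Set.indicator_nonneg (fun _ _ => zero_le_one) _))
    · rw [norm_mul, norm_mul, Complex.norm_natCast]
      have h0 : 0 ≤ (cyl m s 0).indicator (1 : Group m → ℝ) x :=
        Set.indicator_nonneg (fun _ _ => zero_le_one) _
      calc (bigM m s : ℝ) * ‖_‖ * ‖dirichlet m (bigM m s) x‖
          ≤ bigM m s * ((m s : ℝ) * m s) * (bigM m s * (cyl m s 0).indicator 1 x) := by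
            gcongr
            · exact norm_sum_sum_rademacher_pow_le s _ x
            · exact norm_dirichlet_bigM_le hm s x
        _ = m s * (bigM m s * m s * (bigM m s * (cyl m s 0).indicator 1 x)) := by ring
        _ ≤ lam * (bigM m s * m s * (bigM m s * (cyl m s 0).indicator 1 x)) := by gcongr
        _ = _ := by push_cast; ring

/-- The pointwise bound for the Fejér kernel on which the whole argument rests. -/
lemma norm_fejer_le (hm : ∀ k, 2 ≤ m k) {lam : ℕ} (hlam : ∀ k, m k ≤ lam) {n N : ℕ}
    (hn : n < bigM m N) (x : Group m) :
    ‖fejer m n x‖ ≤ 2 * lam ^ 2 * ∑ s ∈ Finset.range N, bigM m s * majorant m s x := by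
  induction N generalizing n with
  | zero =>
    obtain rfl : n = 0 := by simpa [bigM] using hn
    simp [fejer]
  | succ s ih =>
    -- Split off the leading digit `a` of `n`.
    set a := n / bigM m s with ha'
    set b := n % bigM m s with hb'
    have ha : a < m s := Nat.div_lt_of_lt_mul (by rwa [mul_comm])
    have hb : b < bigM m s := Nat.mod_lt _ (bigM_pos m s)
    have hnab : a * bigM m s + b = n := by
      rw [mul_comm]
      exact Nat.div_add_mod n _
    have ha2 : (a : ℝ) ≤ lam := by exact_mod_cast ha.le.trans (hlam s)
    have hlam1 : (1 : ℝ) ≤ lam := by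
      exact_mod_cast (show 1 ≤ lam from le_trans (by decide) ((hm 0).trans (hlam 0)))
    rw [← hnab, fejer_mul_add ha hb.le, fejer_mul ha.le, Finset.sum_range_succ, mul_add, add_comm]
    refine (norm_add_le _ _).trans (add_le_add ?_ ?_)
    · rw [norm_mul, norm_pow, norm_rademacher, one_pow, one_mul]
      exact ih hb
    set I : ℝ := bigM m s * (cyl m s 0).indicator 1 x with hI
    set P : ℝ := ∑ j ∈ Finset.range s, (bigM m j : ℝ) * (spike m j s).indicator 1 x with hP
    have hI0 : 0 ≤ I := (norm_nonneg _).trans (norm_dirichlet_bigM_le hm s x)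
    have hP0 : 0 ≤ P := Finset.sum_nonneg fun j _ =>
      mul_nonneg (Nat.cast_nonneg _) (Set.indicator_nonneg (fun _ _ => zero_le_one) _)
    have hM0 : (0 : ℝ) ≤ bigM m s := Nat.cast_nonneg _
    have hD := norm_dirichlet_bigM_le hm s x
    have h1 : ‖(bigM m s : ℂ) * (∑ i ∈ Finset.range a, ∑ l ∈ Finset.range i,
        rademacher m s x ^ l) * dirichlet m (bigM m s) x‖ ≤ bigM m s * (lam * lam) * I := by
      rw [norm_mul, norm_mul, Complex.norm_natCast]
      gcongr
      exact (norm_sum_sum_rademacher_pow_le s a x).trans (by gcongr)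
    have h2 : ‖(∑ l ∈ Finset.range a, rademacher m s x ^ l) * fejer m (bigM m s) x‖ ≤
        lam * (lam * bigM m s * P) := by
      rw [norm_mul]
      exact mul_le_mul ((norm_sum_rademacher_pow_le s a x).trans ha2)
        (norm_fejer_bigM_le hm hlam s x) (norm_nonneg _) (by positivity)
    have h3 : ‖(b : ℂ) * (∑ l ∈ Finset.range a, rademacher m s x ^ l) *
        dirichlet m (bigM m s) x‖ ≤ bigM m s * (lam * lam) * I := by
      rw [norm_mul, norm_mul, Complex.norm_natCast]
      gcongr
      calc ‖∑ l ∈ Finset.range a, rademacher m s x ^ l‖ ≤ (lam : ℝ) :=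
            (norm_sum_rademacher_pow_le s a x).trans ha2
        _ ≤ lam * lam := le_mul_of_one_le_left (by positivity) hlam1
    refine (norm_add₃_le).trans ((add_le_add_three h1 h2 h3).trans ?_)
    rw [majorant, ← hI, ← hP]
    have : 0 ≤ bigM m s * (lam * lam : ℝ) * P := by positivity
    linarith

/-! ### Haar measure of the Vilenkin group -/

omit [∀ k, NeZero (m k)] in
lemma measurableSet_cyl (n : ℕ) (x : Group m) : MeasurableSet (cyl m n x) := by
  have h : cyl m n x = ⋂ k ∈ Finset.range n, (fun y : Group m => y k) ⁻¹' {x k} := by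
    ext y
    simp [cyl]
  rw [h]
  exact Finset.measurableSet_biInter _ fun k _ => measurable_pi_apply k (MeasurableSet.singleton _)

instance : IsProbabilityMeasure (haar m) := by
  unfold haar
  infer_instance

lemma haar_cyl (n : ℕ) (x : Group m) : haar m (cyl m n x) = (bigM m n : ℝ≥0∞)⁻¹ := by
  have h : cyl m n x = (Finset.range n : Set ℕ).pi fun k => {x k} := by
    ext y
    simp [cyl, Set.mem_pi]
  rw [h, haar, Measure.infinitePi_pi _ fun k _ => MeasurableSet.singleton _]
  induction n with
  | zero => simp [bigM]
  | succ n ih =>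
    rw [Finset.prod_range_succ, ih (by ext y; simp [cyl, Set.mem_pi]), bigM,
      PMF.toMeasure_uniformOfFintype_apply _ (MeasurableSet.singleton _)]
    rw [Nat.cast_mul, ENNReal.mul_inv (by simp [NeZero.ne]) (by simp), mul_comm]
    simp [ZMod.card]

lemma haar_real_cyl (n : ℕ) (x : Group m) : (haar m).real (cyl m n x) = (bigM m n : ℝ)⁻¹ := by
  rw [Measure.real, haar_cyl, ENNReal.toReal_inv, ENNReal.toReal_natCast]

lemma tendsto_haar_cyl (hm : ∀ k, 2 ≤ m k) (x : ℕ → Group m) :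
    Tendsto (fun n => haar m (cyl m n (x n))) atTop (𝓝 0) := by
  simp only [haar_cyl]
  rw [← ENNReal.inv_top]
  exact (ENNReal.tendsto_nat_nhds_top.comp
    (tendsto_natCast_atTop_iff.1 (tendsto_bigM_atTop hm))).inv

instance : (haar m).IsAddLeftInvariant where
  map_add_left_eq_self c := by
    have h := Measure.infinitePi_map_pi (fun k => (PMF.uniformOfFintype (ZMod (m k))).toMeasure)
      (f := fun k y => c k + y) fun k => measurable_from_top
    have h2 (k : ℕ) : ((PMF.uniformOfFintype (ZMod (m k))).toMeasure).map (fun y => c k + y) =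
        (PMF.uniformOfFintype (ZMod (m k))).toMeasure := by
      refine Measure.ext_of_singleton fun a => ?_
      rw [Measure.map_apply measurable_from_top (MeasurableSet.singleton _)]
      have : (fun y => c k + y) ⁻¹' {a} = {a - c k} := by
        ext y
        rw [Set.mem_preimage, Set.mem_singleton_iff, Set.mem_singleton_iff, eq_sub_iff_add_eq']
      simp [this]
    simp only [h2] at h
    exact h

lemma continuous_psi (hm : ∀ k, 2 ≤ m k) (n : ℕ) : Continuous (psi m n) := by
  have h : n < bigM m n := Nat.lt_two_pow_self.trans_le (two_pow_le_bigM hm n)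
  rw [show psi m n = _ from funext (psi_eq_prod h)]
  refine continuous_finsetProd _ fun k _ => Continuous.pow ?_ _
  rw [show rademacher m k = _ from funext (rademacher_eq_stdAddChar k)]
  exact continuous_of_discreteTopology.comp (continuous_apply k)

lemma continuous_psi_sub (hm : ∀ k, 2 ≤ m k) (n : ℕ) (x : Group m) :
    Continuous fun t => psi m n (x - t) :=
  (continuous_psi hm n).comp (continuous_const.sub continuous_id)

lemma continuous_dirichlet_sub (hm : ∀ k, 2 ≤ m k) (n : ℕ) (x : Group m) :
    Continuous fun t => dirichlet m n (x - t) :=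
  continuous_finsetSum _ fun k _ => continuous_psi_sub hm k x

lemma continuous_fejer (hm : ∀ k, 2 ≤ m k) (n : ℕ) : Continuous (fejer m n) :=
  continuous_finsetSum _ fun _ _ => continuous_finsetSum _ fun k _ => continuous_psi hm k

lemma continuous_fejer_sub (hm : ∀ k, 2 ≤ m k) (n : ℕ) (x : Group m) :
    Continuous fun t => fejer m n (x - t) :=
  (continuous_fejer hm n).comp (continuous_const.sub continuous_id)

lemma integrable_continuous {h : Group m → ℂ} (hh : Continuous h) : Integrable h (haar m) :=
  let ⟨C, hC⟩ := isCompact_univ.exists_bound_of_continuousOn hh.continuousOn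
  .of_bound hh.aestronglyMeasurable C (Eventually.of_forall fun t => hC t trivial)

lemma integrable_mul_continuous {f h : Group m → ℂ} (hf : Integrable f (haar m))
    (hh : Continuous h) : Integrable (fun t => f t * h t) (haar m) := by
  obtain ⟨C, hC⟩ := isCompact_univ.exists_bound_of_continuousOn hh.continuousOn
  exact hf.mul_bdd (c := C) hh.aestronglyMeasurable (Eventually.of_forall fun t => hC t trivial)

lemma integral_psi_eq_zero (hm : ∀ k, 2 ≤ m k) {n : ℕ} (hn : n ≠ 0) :
    ∫ t, psi m n t ∂(haar m) = 0 := by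
  obtain ⟨c, hc⟩ := exists_psi_ne_one hm hn
  have h := integral_add_left_eq_self (μ := haar m) (psi m n) c
  simp only [psi_add hm, integral_const_mul] at h
  by_contra h0
  exact hc (mul_eq_right₀ h0 |>.1 h)

/-! ### Partial sums as integrals -/

lemma partialSum_eq_integral (hm : ∀ k, 2 ≤ m k) {f : Group m → ℂ} (hf : Integrable f (haar m))
    (n : ℕ) (x : Group m) :
    partialSum m n f x = ∫ t, f t * dirichlet m n (x - t) ∂(haar m) := by
  simp only [partialSum, fourierCoeff, dirichlet, Finset.mul_sum]
  rw [integral_finsetSum _ fun k _ => integrable_mul_continuous hf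
    (continuous_psi_sub hm k x)]
  refine Finset.sum_congr rfl fun k _ => ?_
  rw [← integral_mul_const]
  congr 1
  ext t
  rw [psi_sub hm]
  ring

lemma sum_partialSum_eq_integral (hm : ∀ k, 2 ≤ m k) {f : Group m → ℂ}
    (hf : Integrable f (haar m)) (n : ℕ) (x : Group m) :
    ∑ k ∈ Finset.range n, partialSum m k f x = ∫ t, f t * fejer m n (x - t) ∂(haar m) := by
  simp only [partialSum_eq_integral hm hf, fejer, Finset.mul_sum]
  rw [integral_finsetSum _ fun k _ => integrable_mul_continuous hf
    (continuous_dirichlet_sub hm k x)]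

/-- The total mass is `n - 1` rather than `n`, because `S_0 = 0`. -/
lemma integral_fejer_sub (hm : ∀ k, 2 ≤ m k) (n : ℕ) (x : Group m) :
    ∫ t, fejer m (n + 1) (x - t) ∂(haar m) = n := by
  have hpsi (k : ℕ) : ∫ t, psi m k (x - t) ∂(haar m) = if k = 0 then 1 else 0 := by
    split_ifs with hk
    · simp [hk, psi_zero]
    · simp only [psi_sub hm, integral_const_mul]
      rw [integral_conj, integral_psi_eq_zero hm hk, map_zero, mul_zero]
  have hD (k : ℕ) : ∫ t, dirichlet m (k + 1) (x - t) ∂(haar m) = 1 := by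
    simp only [dirichlet]
    rw [integral_finsetSum _ fun k _ => integrable_continuous
      (continuous_psi_sub hm k x)]
    simp [hpsi]
  simp only [fejer]
  rw [integral_finsetSum _ fun k _ => integrable_continuous
    (continuous_dirichlet_sub hm k x),
    Finset.sum_range_succ', show ∫ t, dirichlet m 0 (x - t) ∂(haar m) = 0 by simp [dirichlet]]
  simp [hD]

lemma sum_partialSum_sub (hm : ∀ k, 2 ≤ m k) {f : Group m → ℂ}
    (hf : Integrable f (haar m)) (n : ℕ) (x : Group m) :
    ∑ k ∈ Finset.range (n + 1), (partialSum m k f x - f x) =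
      ∫ t, (f t - f x) * fejer m (n + 1) (x - t) ∂(haar m) - f x := by
  have hc : Continuous fun t : Group m => fejer m (n + 1) (x - t) :=
    continuous_fejer_sub hm _ x
  simp only [sub_mul]
  rw [integral_sub (integrable_mul_continuous hf hc) ((integrable_continuous hc).const_mul _),
    integral_const_mul, integral_fejer_sub hm, ← sum_partialSum_eq_integral hm hf,
    Finset.sum_sub_distrib, Finset.sum_const, Finset.card_range, nsmul_eq_mul]
  push_cast
  ring

/-! ### Integrating the majorant -/

/-- A translated majorant is dominated by the cylinders that enter `W_s`, together with the one
around `x`. -/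
lemma majorant_sub_le (hm : ∀ k, 2 ≤ m k) (s : ℕ) (x t : Group m) :
    majorant m s (x - t) ≤ 2 * bigM m s * (cyl m s x).indicator 1 t +
      ∑ j ∈ Finset.range s, (bigM m j : ℝ) * ∑ r ∈ Finset.Ico 1 (m j),
        (cyl m s (x - Pi.single j (r : ZMod (m j)))).indicator 1 t := by
  classical
  have h0 : (cyl m s 0).indicator (1 : Group m → ℝ) (x - t) = (cyl m s x).indicator 1 t := by
    have : x - t ∈ cyl m s 0 ↔ t ∈ cyl m s x := by
      simp only [cyl, Set.mem_ofPred_eq, Pi.sub_apply, Pi.zero_apply, sub_eq_zero]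
      exact forall₂_congr fun _ _ => eq_comm
    simp only [Set.indicator_apply, this, Pi.one_apply]
  have hnn (j : ℕ) (y : Group m) : 0 ≤ (cyl m j y).indicator (1 : Group m → ℝ) t :=
    Set.indicator_nonneg (fun _ _ => zero_le_one) _
  have hj (j : ℕ) : (spike m j s).indicator (1 : Group m → ℝ) (x - t) ≤
      (cyl m s x).indicator 1 t + ∑ r ∈ Finset.Ico 1 (m j),
        (cyl m s (x - Pi.single j (r : ZMod (m j)))).indicator 1 t := by
    by_cases hs : x - t ∈ spike m j s
    · rw [Set.indicator_of_mem hs, Pi.one_apply]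
      -- The coset of the spike that contains `x - t` is the one with `r = x_j - t_j`; for `r = 0` it
      -- is the cylinder around `x`.
      have hmem : t ∈ cyl m s (x - Pi.single j (x j - t j)) := by
        intro k hk
        rw [Pi.sub_apply]
        by_cases hkj : k = j
        · subst hkj
          rw [Pi.single_eq_same, sub_sub_cancel]
        · rw [Pi.single_eq_of_ne hkj, sub_zero]
          exact (sub_eq_zero.1 (hs k hk hkj)).symm
      by_cases hr : x j - t j = 0
      · rw [hr, Pi.single_zero, sub_zero] at hmem
        rw [Set.indicator_of_mem hmem, Pi.one_apply]
        exact le_add_of_nonneg_right (Finset.sum_nonneg fun r _ => hnn _ _)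
      · refine le_add_of_nonneg_of_le (hnn _ _) ?_
        have hcast : (((x j - t j).val : ℕ) : ZMod (m j)) = x j - t j :=
          ZMod.natCast_rightInverse _
        refine le_trans ?_ (Finset.single_le_sum (fun r _ => hnn _ _) (Finset.mem_Ico.2
          ⟨Nat.one_le_iff_ne_zero.2 (mt (ZMod.val_eq_zero _).1 hr), ZMod.val_lt (x j - t j)⟩))
        rw [hcast, Set.indicator_of_mem hmem, Pi.one_apply]
    · rw [Set.indicator_of_notMem hs]
      exact add_nonneg (hnn _ _) (Finset.sum_nonneg fun r _ => hnn _ _)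
  have hM : (∑ j ∈ Finset.range s, (bigM m j : ℝ)) ≤ bigM m s := by
    exact_mod_cast sum_bigM_le hm s
  rw [majorant, h0]
  calc _ ≤ bigM m s * (cyl m s x).indicator 1 t + ∑ j ∈ Finset.range s, (bigM m j : ℝ) *
        ((cyl m s x).indicator 1 t + ∑ r ∈ Finset.Ico 1 (m j),
          (cyl m s (x - Pi.single j (r : ZMod (m j)))).indicator 1 t) := by
        gcongr with j
        exact hj j
    _ ≤ _ := by
        simp only [mul_add, Finset.sum_add_distrib, ← Finset.sum_mul]
        have := mul_le_mul_of_nonneg_right hM (hnn s x)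
        linarith

/-- The sum of integrals over cylinders that controls `∫ g(t) R_s(x - t) dμ(t)`. -/
def cylMean (m : ℕ → ℕ) [∀ k, NeZero (m k)] (s : ℕ) (g : Group m → ℝ) (x : Group m) : ℝ :=
  2 * (bigM m s * ∫ t in cyl m s x, g t ∂(haar m)) +
    ∑ j ∈ Finset.range s, (bigM m j : ℝ) * ∑ r ∈ Finset.Ico 1 (m j),
      ∫ t in cyl m s (x - Pi.single j (r : ZMod (m j))), g t ∂(haar m)

/-- Integrated form of the Fejér kernel bound. -/
lemma integral_mul_norm_fejer_le (hm : ∀ k, 2 ≤ m k) {lam : ℕ} (hlam : ∀ k, m k ≤ lam) {n N : ℕ}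
    (hn : n < bigM m N) {g : Group m → ℝ} (hg : Integrable g (haar m)) (hg0 : ∀ t, 0 ≤ g t)
    (x : Group m) :
    ∫ t, g t * ‖fejer m n (x - t)‖ ∂(haar m) ≤
      2 * lam ^ 2 * ∑ s ∈ Finset.range N, bigM m s * cylMean m s g x := by
  have hind {s : ℕ} (y : Group m) :
      Integrable (fun t => g t * (cyl m s y).indicator 1 t) (haar m) := by
    have : (fun t => g t * (cyl m s y).indicator 1 t) = (cyl m s y).indicator g := by
      ext t
      by_cases ht : t ∈ cyl m s y <;> simp [ht]
    rw [this]
    exact hg.indicator (measurableSet_cyl _ _)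
  have hint {s : ℕ} (y : Group m) : ∫ t, g t * (cyl m s y).indicator 1 t ∂(haar m) =
      ∫ t in cyl m s y, g t ∂(haar m) := by
    rw [← integral_indicator (measurableSet_cyl _ _)]
    congr 1
    ext t
    by_cases ht : t ∈ cyl m s y <;> simp [ht]
  have hI (s : ℕ) : Integrable (fun t => ∑ j ∈ Finset.range s, (bigM m j : ℝ) *
      ∑ r ∈ Finset.Ico 1 (m j), g t *
        (cyl m s (x - Pi.single j (r : ZMod (m j)))).indicator 1 t) (haar m) :=
    integrable_finsetSum _ fun j _ => (integrable_finsetSum _ fun r _ => hind _).const_mul _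
  have hJ (s : ℕ) : Integrable (fun t => 2 * bigM m s * (g t * (cyl m s x).indicator 1 t) +
      ∑ j ∈ Finset.range s, (bigM m j : ℝ) * ∑ r ∈ Finset.Ico 1 (m j), g t *
        (cyl m s (x - Pi.single j (r : ZMod (m j)))).indicator 1 t) (haar m) :=
    ((hind x).const_mul _).add (hI s)
  have hmean (s : ℕ) : ∫ t, (2 * bigM m s * (g t * (cyl m s x).indicator 1 t) +
      ∑ j ∈ Finset.range s, (bigM m j : ℝ) * ∑ r ∈ Finset.Ico 1 (m j), g t *
        (cyl m s (x - Pi.single j (r : ZMod (m j)))).indicator 1 t) ∂(haar m) =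
      cylMean m s g x := by
    rw [integral_add ((hind x).const_mul _) (hI s), integral_const_mul, hint,
      integral_finsetSum _ fun j _ => (integrable_finsetSum _ fun r _ => hind _).const_mul _,
      cylMean, mul_assoc]
    congr 1
    refine Finset.sum_congr rfl fun j _ => ?_
    rw [integral_const_mul, integral_finsetSum _ fun r _ => hind _]
    simp only [hint]
  have hpt (t : Group m) : g t * ‖fejer m n (x - t)‖ ≤ 2 * lam ^ 2 * ∑ s ∈ Finset.range N,
      bigM m s * (2 * bigM m s * (g t * (cyl m s x).indicator 1 t) +
      ∑ j ∈ Finset.range s, (bigM m j : ℝ) * ∑ r ∈ Finset.Ico 1 (m j), g t *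
        (cyl m s (x - Pi.single j (r : ZMod (m j)))).indicator 1 t) := by
    refine (mul_le_mul_of_nonneg_left (norm_fejer_le hm hlam hn (x - t)) (hg0 t)).trans ?_
    rw [mul_left_comm, Finset.mul_sum]
    refine mul_le_mul_of_nonneg_left (Finset.sum_le_sum fun s _ => ?_) (by positivity)
    rw [mul_left_comm]
    refine mul_le_mul_of_nonneg_left ((mul_le_mul_of_nonneg_left
      (majorant_sub_le hm s x t) (hg0 t)).trans_eq ?_) (Nat.cast_nonneg _)
    simp only [mul_add, Finset.mul_sum]
    congr 1
    · ring
    · exact Finset.sum_congr rfl fun j _ => Finset.sum_congr rfl fun r _ => by ring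
  refine (integral_mono_of_nonneg (Eventually.of_forall fun t =>
    mul_nonneg (hg0 t) (norm_nonneg _)) ((integrable_finsetSum _ fun s _ =>
    (hJ s).const_mul _).const_mul _) (Eventually.of_forall hpt)).trans_eq ?_
  rw [integral_const_mul, integral_finsetSum _ fun s _ => (hJ s).const_mul _]
  congr 1
  refine Finset.sum_congr rfl fun s _ => ?_
  rw [integral_const_mul, hmean]

/-! ### Convergence at Vilenkin–Lebesgue points and at points of continuity -/

lemma cylMean_norm_sub (s : ℕ) (f : Group m → ℂ) (x : Group m) :
    cylMean m s (fun t => ‖f t - f x‖) x =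
      2 * (bigM m s * ∫ t in cyl m s x, ‖f t - f x‖ ∂(haar m)) + W m s f x := rfl

/-- Splitting `I_s(x)` according to the `s`-th coordinate. -/
lemma setIntegral_cyl_le (s : ℕ) {f : Group m → ℂ} (hf : Integrable f (haar m)) (x : Group m) :
    ∫ t in cyl m s x, ‖f t - f x‖ ∂(haar m) ≤
      ∫ t in cyl m (s + 1) x, ‖f t - f x‖ ∂(haar m) + W m (s + 1) f x / bigM m s := by
  have hg : Integrable (fun t => ‖f t - f x‖) (haar m) := (hf.sub (integrable_const _)).norm
  set g : Group m → ℝ := fun t => ‖f t - f x‖ with hgdef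
  have hg0 (t : Group m) : 0 ≤ g t := norm_nonneg _
  have hM : (0 : ℝ) < bigM m s := by exact_mod_cast bigM_pos m s
  have hW : bigM m s * ∑ r ∈ Finset.Ico 1 (m s),
      ∫ t in cyl m (s + 1) (x - Pi.single s (r : ZMod (m s))), g t ∂(haar m) ≤ W m (s + 1) f x := by
    rw [W, Finset.sum_range_succ]
    exact le_add_of_nonneg_left (Finset.sum_nonneg fun j _ => mul_nonneg (Nat.cast_nonneg _)
      (Finset.sum_nonneg fun r _ => integral_nonneg fun t => norm_nonneg _))
  rw [← sub_le_iff_le_add', le_div_iff₀ hM]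
  refine le_trans ?_ hW
  rw [mul_comm]
  refine mul_le_mul_of_nonneg_left ?_ hM.le
  rw [sub_le_iff_le_add']
  have hind (n : ℕ) (y : Group m) : Integrable ((cyl m n y).indicator g) (haar m) :=
    hg.indicator (measurableSet_cyl n y)
  simp only [← integral_indicator (measurableSet_cyl _ _)]
  rw [← integral_finsetSum _ fun r _ => hind _ _, ← integral_add (hind _ _)
    (integrable_finsetSum _ fun r _ => hind _ _)]
  refine integral_mono (hind _ _) ((hind _ _).add (integrable_finsetSum _ fun r _ => hind _ _))
    fun t => ?_
  have hnn (n : ℕ) (y : Group m) : 0 ≤ (cyl m n y).indicator g t :=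
    Set.indicator_nonneg (fun t _ => hg0 t) _
  by_cases ht : t ∈ cyl m s x
  · rw [Set.indicator_of_mem ht]
    -- `t` lies in the piece with `r = x_s - t_s`.
    have hmem : t ∈ cyl m (s + 1) (x - Pi.single s (x s - t s)) := by
      intro k hk
      rw [Pi.sub_apply]
      rcases Nat.lt_succ_iff_lt_or_eq.1 hk with hk | rfl
      · rw [Pi.single_eq_of_ne hk.ne, sub_zero]
        exact ht k hk
      · rw [Pi.single_eq_same, sub_sub_cancel]
    by_cases hr : x s - t s = 0
    · rw [hr, Pi.single_zero, sub_zero] at hmem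
      rw [Set.indicator_of_mem hmem]
      exact le_add_of_nonneg_right (Finset.sum_nonneg fun r _ => hnn _ _)
    · refine le_add_of_nonneg_of_le (hnn _ _) ?_
      have hcast : (((x s - t s).val : ℕ) : ZMod (m s)) = x s - t s :=
        ZMod.natCast_rightInverse _
      refine le_trans ?_ (Finset.single_le_sum (fun r _ => hnn _ _) (Finset.mem_Ico.2
        ⟨Nat.one_le_iff_ne_zero.2 (mt (ZMod.val_eq_zero _).1 hr), ZMod.val_lt (x s - t s)⟩))
      rw [hcast, Set.indicator_of_mem hmem]
  · rw [Set.indicator_of_notMem ht]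
    exact add_nonneg (hnn _ _) (Finset.sum_nonneg fun r _ => hnn _ _)

/-- A Vilenkin–Lebesgue point is a Lebesgue point with respect to the cylinders around it: the
integrals `b_s` over `I_s(x)` tend to zero and satisfy `b_s ≤ b_{s+1} + W_{s+1} / M_s`, so that `b_s`
is at most `2 sup_{i > s} W_i / M_s`. -/
lemma IsVilenkinLebesguePoint.tendsto_cyl (hm : ∀ k, 2 ≤ m k) {f : Group m → ℂ} {x : Group m}
    (h : IsVilenkinLebesguePoint m f x) :
    Tendsto (fun s => bigM m s * ∫ t in cyl m s x, ‖f t - f x‖ ∂(haar m)) atTop (𝓝 0) := by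
  obtain ⟨hf, hW⟩ := h
  set b : ℕ → ℝ := fun s => ∫ t in cyl m s x, ‖f t - f x‖ ∂(haar m) with hb
  have hg : Integrable (fun t => ‖f t - f x‖) (haar m) := (hf.sub (integrable_const _)).norm
  have hb0 : Tendsto b atTop (𝓝 0) :=
    hg.tendsto_setIntegral_nhds_zero (tendsto_haar_cyl hm fun _ => x)
  have hbnn (s : ℕ) : 0 ≤ b s := integral_nonneg fun t => norm_nonneg _
  have hMpos (s : ℕ) : (0 : ℝ) < bigM m s := by exact_mod_cast bigM_pos m s
  rw [Metric.tendsto_atTop]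
  intro ε hε
  obtain ⟨K, hK⟩ := eventually_atTop.1 (hW.eventually_lt_const (show 0 < ε / 4 by positivity))
  -- Since `2 / M_{s+1} ≤ 1 / M_s`, subtracting `(ε / 2) / M_s` absorbs the increment
  -- `W_{s+1} / M_s ≤ (ε / 4) / M_s`; what remains is eventually monotone with limit zero,
  -- hence nonpositive.
  have hstep (s : ℕ) (hs : K ≤ s) :
      b s - (ε / 2) / bigM m s ≤ b (s + 1) - (ε / 2) / bigM m (s + 1) := by
    have h1 := setIntegral_cyl_le s hf x
    have h2 : W m (s + 1) f x / bigM m s ≤ (ε / 4) / bigM m s :=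
      div_le_div_of_nonneg_right (hK _ (by omega)).le (hMpos s).le
    have h3 : (ε / 2) / bigM m (s + 1) ≤ (ε / 4) / bigM m s := by
      rw [div_le_div_iff₀ (hMpos _) (hMpos _)]
      have : (2 : ℝ) * bigM m s ≤ bigM m (s + 1) := by exact_mod_cast two_mul_bigM_le hm s
      nlinarith
    have h4 : (ε / 2) / bigM m s = 2 * ((ε / 4) / bigM m s) := by ring
    simp only [hb]
    linarith
  have hmono : Monotone fun i => b (i + K) - (ε / 2) / bigM m (i + K) :=
    monotone_nat_of_le_succ fun i => by
      have := hstep (i + K) (by omega)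
      rwa [add_right_comm] at this
  have hlim : Tendsto (fun s => b s - (ε / 2) / bigM m s) atTop (𝓝 0) := by
    simpa using hb0.sub ((tendsto_bigM_atTop hm).const_div_atTop (ε / 2))
  have hlim' := (tendsto_add_atTop_iff_nat K).2 hlim
  refine ⟨K, fun s hs => ?_⟩
  have := hmono.ge_of_tendsto hlim' (s - K)
  simp only [Nat.sub_add_cancel hs] at this
  rw [Real.dist_eq, sub_zero, abs_of_nonneg (mul_nonneg (hMpos s).le (hbnn s))]
  have h5 : b s ≤ (ε / 2) / bigM m s := by linarith
  rw [le_div_iff₀ (hMpos s)] at h5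
  rw [mul_comm]
  linarith

/-- Fejér means converge at Vilenkin–Lebesgue points. -/
lemma IsVilenkinLebesguePoint.tendsto_fejer (hm : ∀ k, 2 ≤ m k) (hbdd : BddAbove (Set.range m))
    {f : Group m → ℂ} {x : Group m} (h : IsVilenkinLebesguePoint m f x) :
    Tendsto (fun n : ℕ => (n : ℝ)⁻¹ • ∑ k ∈ Finset.range n, (partialSum m k f x - f x))
      atTop (𝓝 0) := by
  obtain ⟨lam, hlam⟩ := hbdd
  replace hlam (k : ℕ) : m k ≤ lam := hlam ⟨k, rfl⟩
  have hf := h.1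
  have hg : Integrable (fun t => ‖f t - f x‖) (haar m) := (hf.sub (integrable_const _)).norm
  set c : ℕ → ℝ := fun s => cylMean m s (fun t => ‖f t - f x‖) x with hc
  have hc0 : Tendsto c atTop (𝓝 0) := by
    simpa [hc, cylMean_norm_sub] using ((h.tendsto_cyl hm).const_mul 2).add h.2
  have hcnn (s : ℕ) : 0 ≤ c s :=
    add_nonneg (mul_nonneg zero_le_two (mul_nonneg (Nat.cast_nonneg _)
      (integral_nonneg fun t => norm_nonneg _))) (Finset.sum_nonneg fun j _ =>
      mul_nonneg (Nat.cast_nonneg _) (Finset.sum_nonneg fun r _ =>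
        integral_nonneg fun t => norm_nonneg _))
  have hlim : Tendsto (fun N => 2 * lam ^ 2 *
      ∑ s ∈ Finset.range (N + 1), ((bigM m s : ℝ) / bigM m N) * c s + ‖f x‖ / bigM m N)
      atTop (𝓝 0) := by
    simpa using ((tendsto_bigM_mean_zero hm hc0).const_mul (2 * (lam : ℝ) ^ 2)).add
      ((tendsto_bigM_atTop hm).const_div_atTop ‖f x‖)
  rw [Metric.tendsto_atTop]
  intro ε hε
  obtain ⟨K, hK⟩ := eventually_atTop.1 (hlim.eventually_lt_const hε)
  refine ⟨bigM m K, fun n hn => ?_⟩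
  obtain ⟨N, hKN, hNn, hnN⟩ := exists_bigM_le_lt hm hn
  have hMpos : (0 : ℝ) < bigM m N := by exact_mod_cast bigM_pos m N
  have hnpos : 0 < n := (bigM_pos m N).trans_le hNn
  have hMn : (bigM m N : ℝ) ≤ n := by exact_mod_cast hNn
  refine lt_of_le_of_lt ?_ (hK N hKN)
  rw [dist_zero_right, norm_smul, norm_inv, Real.norm_natCast]
  have hbound : ‖∑ k ∈ Finset.range n, (partialSum m k f x - f x)‖ ≤
      2 * lam ^ 2 * ∑ s ∈ Finset.range (N + 1), bigM m s * c s + ‖f x‖ := by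
    obtain ⟨n', rfl⟩ := Nat.exists_eq_succ_of_ne_zero hnpos.ne'
    rw [Nat.succ_eq_add_one, sum_partialSum_sub hm hf]
    refine (norm_sub_le _ _).trans (add_le_add_left ?_ _)
    refine (norm_integral_le_integral_norm _).trans ?_
    simp only [norm_mul]
    exact integral_mul_norm_fejer_le hm hlam hnN hg (fun t => norm_nonneg _) x
  calc (n : ℝ)⁻¹ * ‖∑ k ∈ Finset.range n, (partialSum m k f x - f x)‖
      ≤ (bigM m N : ℝ)⁻¹ * (2 * lam ^ 2 * ∑ s ∈ Finset.range (N + 1), bigM m s * c s + ‖f x‖) :=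
        mul_le_mul (inv_anti₀ hMpos hMn) hbound (norm_nonneg _) (by positivity)
    _ = _ := by
        simp only [mul_add, Finset.mul_sum]
        congr 1
        · refine Finset.sum_congr rfl fun s _ => ?_
          ring
        · ring

omit [∀ k, NeZero (m k)] in
lemma exists_cyl_subset {x : Group m} {U : Set (Group m)} (hU : U ∈ 𝓝 x) :
    ∃ K, cyl m K x ⊆ U := by
  rw [nhds_pi, Filter.mem_pi] at hU
  obtain ⟨I, hI, t, ht, hsub⟩ := hU
  obtain ⟨K, hK⟩ := hI.bddAbove
  refine ⟨K + 1, fun y hy => hsub fun k hk => ?_⟩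
  rw [hy k (Nat.lt_succ_of_le (hK hk))]
  exact mem_of_mem_nhds (ht k)

lemma sum_bigM_mul_pred_le (n : ℕ) :
    ∑ s ∈ Finset.range n, (bigM m s : ℝ) * ∑ _r ∈ Finset.Ico 1 (m s), (1 : ℝ) ≤ bigM m n := by
  induction n with
  | zero => simp
  | succ n ih =>
    rw [Finset.sum_range_succ, bigM]
    have h1 : 1 ≤ m n := Nat.one_le_iff_ne_zero.2 (NeZero.ne _)
    simp only [Finset.sum_const, Nat.card_Ico, nsmul_eq_mul, mul_one, Nat.cast_mul,
      Nat.cast_sub h1] at ih ⊢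
    push_cast
    linarith

/-- At a point of continuity, the cylinders `I_n(x - r e_s)` with `s` large lie where `f` is close
to `f x`, and for each of the finitely many remaining `s` their measure tends to zero. -/
lemma isVilenkinLebesguePoint_of_continuousAt (hm : ∀ k, 2 ≤ m k) {f : Group m → ℂ}
    (hf : Integrable f (haar m)) {x : Group m} (hx : ContinuousAt f x) :
    IsVilenkinLebesguePoint m f x := by
  refine ⟨hf, ?_⟩
  have hg : Integrable (fun t => ‖f t - f x‖) (haar m) := (hf.sub (integrable_const _)).norm
  rw [Metric.tendsto_atTop]
  intro ε hε
  obtain ⟨K, hK⟩ := exists_cyl_subset (Metric.continuousAt_iff'.1 hx (ε / 2) (half_pos hε))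
  have hhead : Tendsto (fun n => ∑ s ∈ Finset.range K, (bigM m s : ℝ) * ∑ r ∈ Finset.Ico 1 (m s),
      ∫ t in cyl m n (x - Pi.single s (r : ZMod (m s))), ‖f t - f x‖ ∂(haar m))
      atTop (𝓝 0) := by
    have h0 (s r : ℕ) := hg.tendsto_setIntegral_nhds_zero
      (tendsto_haar_cyl hm fun _ => x - Pi.single s (r : ZMod (m s)))
    simpa using tendsto_finsetSum (Finset.range K) fun s _ =>
      (tendsto_finsetSum (Finset.Ico 1 (m s)) fun r _ => h0 s r).const_mul (bigM m s : ℝ)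
  obtain ⟨N, hN⟩ := eventually_atTop.1 (hhead.eventually_lt_const (half_pos hε))
  refine ⟨max N K, fun n hn => ?_⟩
  have hMpos : (0 : ℝ) < bigM m n := by exact_mod_cast bigM_pos m n
  have hnn (s r : ℕ) : 0 ≤ ∫ t in cyl m n (x - Pi.single s (r : ZMod (m s))),
    ‖f t - f x‖ ∂(haar m) := integral_nonneg fun t => norm_nonneg _
  have hsnn (s : ℕ) : 0 ≤ (bigM m s : ℝ) * ∑ r ∈ Finset.Ico 1 (m s),
      ∫ t in cyl m n (x - Pi.single s (r : ZMod (m s))), ‖f t - f x‖ ∂(haar m) :=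
    mul_nonneg (Nat.cast_nonneg _) (Finset.sum_nonneg fun r _ => hnn s r)
  have hint (s r : ℕ) (hKs : K ≤ s) :
      ∫ t in cyl m n (x - Pi.single s (r : ZMod (m s))), ‖f t - f x‖ ∂(haar m) ≤
        ε / 2 / bigM m n := by
    calc _ ≤ ∫ t in cyl m n (x - Pi.single s (r : ZMod (m s))), ε / 2 ∂(haar m) := by
          refine setIntegral_mono_on hg.integrableOn (integrable_const _).integrableOn
            (measurableSet_cyl _ _) fun t ht => ?_
          have htK : t ∈ cyl m K x := fun k hk => by
            rw [ht k (by omega), Pi.sub_apply, Pi.single_eq_of_ne (by omega), sub_zero]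
          have := hK htK
          rw [← dist_eq_norm]
          exact le_of_lt this
      _ = ε / 2 / bigM m n := by
          rw [setIntegral_const, haar_real_cyl, smul_eq_mul, mul_comm, ← div_eq_mul_inv]
  have htail : ∑ s ∈ Finset.Ico K n, (bigM m s : ℝ) * ∑ r ∈ Finset.Ico 1 (m s),
      ∫ t in cyl m n (x - Pi.single s (r : ZMod (m s))), ‖f t - f x‖ ∂(haar m) ≤ ε / 2 := by
    calc _ ≤ ∑ s ∈ Finset.Ico K n, (bigM m s : ℝ) * ∑ r ∈ Finset.Ico 1 (m s),
          ε / 2 / bigM m n := by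
          gcongr with s hs r
          exact hint s r (Finset.mem_Ico.1 hs).1
      _ ≤ ∑ s ∈ Finset.range n, (bigM m s : ℝ) * ∑ r ∈ Finset.Ico 1 (m s),
          ε / 2 / bigM m n := by
          refine Finset.sum_le_sum_of_subset_of_nonneg (fun s hs => ?_) fun s _ _ => by positivity
          exact Finset.mem_range.2 (Finset.mem_Ico.1 hs).2
      _ = (∑ s ∈ Finset.range n, (bigM m s : ℝ) * ∑ _r ∈ Finset.Ico 1 (m s), (1 : ℝ)) *
          (ε / 2 / bigM m n) := by
          simp only [Finset.sum_mul, Finset.mul_sum, mul_assoc, one_mul]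
      _ ≤ bigM m n * (ε / 2 / bigM m n) := by
          gcongr
          exact sum_bigM_mul_pred_le n
      _ = ε / 2 := mul_div_cancel₀ _ hMpos.ne'
  have hW : W m n f x = _ := (Finset.sum_range_add_sum_Ico _ ((le_max_right N K).trans hn)).symm
  rw [Real.dist_eq, sub_zero, abs_of_nonneg (show 0 ≤ W m n f x from Finset.sum_nonneg fun s _ => hsnn s), hW]
  have := hN n ((le_max_left N K).trans hn)
  linarith

/-! ### Convergence in `L_p` -/

/-- **Schur's test** with equal row and column bounds. For fixed `x`, the power mean inequality is
applied to the measure with density `‖K x ·‖ₑ`. -/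
lemma eLpNorm_integral_mul_le {α : Type*} [MeasurableSpace α] {μ : Measure α} [SFinite μ]
    {K : α → α → ℂ} (hK : Measurable (Function.uncurry K)) {C : ℝ≥0∞} (hC : C ≠ ∞)
    (hrow : ∀ x, ∫⁻ t, ‖K x t‖ₑ ∂μ ≤ C) (hcol : ∀ t, ∫⁻ x, ‖K x t‖ₑ ∂μ ≤ C)
    {p : ℝ≥0∞} (hp : 1 ≤ p) (hp' : p ≠ ∞) {h : α → ℂ} (hh : AEStronglyMeasurable h μ) :
    eLpNorm (fun x => ∫ t, h t * K x t ∂μ) p μ ≤ C * eLpNorm h p μ := by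
  have hp0 : p ≠ 0 := (zero_lt_one.trans_le hp).ne'
  have hpr : 0 < p.toReal := ENNReal.toReal_pos hp0 hp'
  have hp1 : 1 ≤ p.toReal := by
    simpa using ENNReal.toReal_mono hp' hp
  have hKx (x : α) : Measurable fun t => ‖K x t‖ₑ := (hK.comp measurable_prodMk_left).enorm
  have hpt (x : α) : ‖∫ t, h t * K x t ∂μ‖ₑ ^ p.toReal ≤
      C ^ (p.toReal - 1) * ∫⁻ t, ‖K x t‖ₑ * ‖h t‖ₑ ^ p.toReal ∂μ := by
    set ν := μ.withDensity fun t => ‖K x t‖ₑ with hν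
    have hac : ν ≪ μ := withDensity_absolutelyContinuous _ _
    have huniv : ν Set.univ ≤ C := by
      rw [hν, withDensity_apply _ MeasurableSet.univ, Measure.restrict_univ]
      exact hrow x
    have h1 : ‖∫ t, h t * K x t ∂μ‖ₑ ≤ eLpNorm h 1 ν := by
      rw [eLpNorm_one_eq_lintegral_enorm, hν,
        lintegral_withDensity_eq_lintegral_mul₀ (hKx x).aemeasurable hh.enorm]
      refine (enorm_integral_le_lintegral_enorm _).trans_eq (lintegral_congr fun t => ?_)
      rw [enorm_mul, mul_comm, Pi.mul_apply]
    have h2 : eLpNorm h 1 ν ≤ eLpNorm h p ν * C ^ (1 - 1 / p.toReal) := by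
      refine (eLpNorm_le_eLpNorm_mul_rpow_measure_univ hp (hh.mono_ac hac)).trans ?_
      rw [ENNReal.toReal_one, div_one]
      gcongr
      rw [sub_nonneg, div_le_one hpr]
      exact hp1
    calc ‖∫ t, h t * K x t ∂μ‖ₑ ^ p.toReal
        ≤ (eLpNorm h p ν * C ^ (1 - 1 / p.toReal)) ^ p.toReal :=
          ENNReal.rpow_le_rpow (h1.trans h2) hpr.le
      _ = C ^ (p.toReal - 1) * ∫⁻ t, ‖h t‖ₑ ^ p.toReal ∂ν := by
          rw [ENNReal.mul_rpow_of_nonneg _ _ hpr.le, ← ENNReal.rpow_mul, mul_comm,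
            eLpNorm_eq_lintegral_rpow_enorm_toReal hp0 hp', ← ENNReal.rpow_mul,
            one_div_mul_cancel hpr.ne', ENNReal.rpow_one, sub_mul, one_mul,
            one_div_mul_cancel hpr.ne']
      _ = _ := by
          rw [hν, lintegral_withDensity_eq_lintegral_mul₀ (hKx x).aemeasurable
            (hh.enorm.pow_const _)]
          rfl
  have hswap : ∫⁻ x, ∫⁻ t, ‖K x t‖ₑ * ‖h t‖ₑ ^ p.toReal ∂μ ∂μ =
      ∫⁻ t, ∫⁻ x, ‖K x t‖ₑ * ‖h t‖ₑ ^ p.toReal ∂μ ∂μ :=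
    lintegral_lintegral_swap (hK.enorm.aemeasurable.mul (hh.enorm.pow_const _).comp_snd)
  have hcolp (t : α) : ∫⁻ x, ‖K x t‖ₑ * ‖h t‖ₑ ^ p.toReal ∂μ ≤ C * ‖h t‖ₑ ^ p.toReal := by
    have hKt : Measurable fun x => ‖K x t‖ₑ := (hK.comp measurable_prodMk_right).enorm
    rw [lintegral_mul_const _ hKt]
    gcongr
    exact hcol t
  have hmain : ∫⁻ x, ‖∫ t, h t * K x t ∂μ‖ₑ ^ p.toReal ∂μ ≤
      C ^ p.toReal * ∫⁻ t, ‖h t‖ₑ ^ p.toReal ∂μ := by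
    calc _ ≤ ∫⁻ x, C ^ (p.toReal - 1) * ∫⁻ t, ‖K x t‖ₑ * ‖h t‖ₑ ^ p.toReal ∂μ ∂μ :=
          lintegral_mono hpt
      _ = C ^ (p.toReal - 1) * ∫⁻ t, ∫⁻ x, ‖K x t‖ₑ * ‖h t‖ₑ ^ p.toReal ∂μ ∂μ := by
          rw [lintegral_const_mul' _ _ (ENNReal.rpow_ne_top_of_nonneg (by linarith) hC), hswap]
      _ ≤ C ^ (p.toReal - 1) * ∫⁻ t, C * ‖h t‖ₑ ^ p.toReal ∂μ := by
          gcongr with t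
          exact hcolp t
      _ = _ := by
          rw [lintegral_const_mul' _ _ hC, ← mul_assoc]
          congr 1
          nth_rewrite 2 [← ENNReal.rpow_one C]
          rw [← ENNReal.rpow_add_of_nonneg _ _ (by linarith) zero_le_one, sub_add_cancel]
  rw [eLpNorm_eq_lintegral_rpow_enorm_toReal hp0 hp', eLpNorm_eq_lintegral_rpow_enorm_toReal hp0 hp']
  refine (ENNReal.rpow_le_rpow hmain (by positivity)).trans_eq ?_
  rw [ENNReal.mul_rpow_of_nonneg _ _ (by positivity), ← ENNReal.rpow_mul,
    mul_one_div_cancel hpr.ne', ENNReal.rpow_one]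

lemma tendsto_eLpNorm_zero_of_bounded {α : Type*} [MeasurableSpace α] {μ : Measure α}
    [IsFiniteMeasure μ] {F : ℕ → α → ℂ} (hF : ∀ n, AEStronglyMeasurable (F n) μ) {B : ℝ≥0∞}
    (hB : B ≠ ∞) (hFB : ∀ n x, ‖F n x‖ₑ ≤ B) (hlim : ∀ x, Tendsto (fun n => F n x) atTop (𝓝 0))
    {p : ℝ≥0∞} (hp0 : p ≠ 0) (hp' : p ≠ ∞) :
    Tendsto (fun n => eLpNorm (F n) p μ) atTop (𝓝 0) := by
  have hpr : 0 < p.toReal := ENNReal.toReal_pos hp0 hp'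
  have h : Tendsto (fun n => ∫⁻ x, ‖F n x‖ₑ ^ p.toReal ∂μ) atTop (𝓝 (∫⁻ _, 0 ∂μ)) := by
    refine tendsto_lintegral_of_dominated_convergence' (fun _ => B ^ p.toReal)
      (fun n => (hF n).enorm.pow_const _)
      (fun n => Eventually.of_forall fun x => ENNReal.rpow_le_rpow (hFB n x) hpr.le) ?_
      (Eventually.of_forall fun x => ?_)
    · rw [lintegral_const]
      exact ENNReal.mul_ne_top (ENNReal.rpow_ne_top_of_nonneg hpr.le hB) (measure_ne_top _ _)
    · have := (ENNReal.continuous_rpow_const (y := p.toReal)).tendsto _ |>.comp (hlim x).enorm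
      simpa [Function.comp_def, ENNReal.zero_rpow_of_pos hpr] using this
  simp only [eLpNorm_eq_lintegral_rpow_enorm_toReal hp0 hp']
  have := (ENNReal.continuous_rpow_const (y := 1 / p.toReal)).tendsto _ |>.comp h
  simpa [Function.comp_def, ENNReal.zero_rpow_of_pos (inv_pos.2 hpr)] using this

/-- The Fejér kernels have uniformly bounded `L_1` norms. -/
lemma lintegral_enorm_fejer_le (hm : ∀ k, 2 ≤ m k) {lam : ℕ} (hlam : ∀ k, m k ≤ lam) (n : ℕ)
    (x : Group m) :
    ∫⁻ t, ‖(n : ℂ)⁻¹ * fejer m n (x - t)‖ₑ ∂(haar m) ≤ ENNReal.ofReal (12 * lam ^ 2) := by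
  rcases Nat.eq_zero_or_pos n with rfl | hn
  · simp
  obtain ⟨N, -, hNn, hnN⟩ := exists_bigM_le_lt hm (n := n) (K := 0) hn
  have hc := continuous_fejer_sub hm n x
  have hnpos : (0 : ℝ) < n := by exact_mod_cast hn
  have hMpos (s : ℕ) : (0 : ℝ) < bigM m s := by exact_mod_cast bigM_pos m s
  have hint : Integrable (fun t => (n : ℂ)⁻¹ * fejer m n (x - t)) (haar m) :=
    (integrable_continuous hc).const_mul _
  rw [← ofReal_integral_norm_eq_lintegral_enorm hint]
  refine ENNReal.ofReal_le_ofReal ?_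
  have hmean (s : ℕ) : cylMean m s (fun _ => 1) x ≤ 3 := by
    have h1 (n : ℕ) (y : Group m) : ∫ _ in cyl m n y, (1 : ℝ) ∂(haar m) = (bigM m n : ℝ)⁻¹ := by
      rw [setIntegral_const, haar_real_cyl, smul_eq_mul, mul_one]
    have h2 : ∑ j ∈ Finset.range s, (bigM m j : ℝ) * ∑ _r ∈ Finset.Ico 1 (m j),
        (bigM m s : ℝ)⁻¹ ≤ 1 := by
      calc _ = (∑ j ∈ Finset.range s, (bigM m j : ℝ) * ∑ _r ∈ Finset.Ico 1 (m j), (1 : ℝ)) *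
            (bigM m s : ℝ)⁻¹ := by
            simp only [Finset.sum_mul, Finset.mul_sum, mul_assoc, one_mul]
        _ ≤ bigM m s * (bigM m s : ℝ)⁻¹ := by
            gcongr
            exact sum_bigM_mul_pred_le s
        _ = 1 := mul_inv_cancel₀ (hMpos s).ne'
    simp only [cylMean, h1, mul_inv_cancel₀ (hMpos s).ne']
    linarith
  have h := integral_mul_norm_fejer_le hm hlam hnN (integrable_const (1 : ℝ))
    (fun _ => zero_le_one) x
  simp only [one_mul] at h
  simp only [norm_mul, norm_inv, Complex.norm_natCast]
  rw [integral_const_mul, inv_mul_le_iff₀ hnpos]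
  have hM : ∑ s ∈ Finset.range N, (bigM m s : ℝ) ≤ bigM m N := by exact_mod_cast sum_bigM_le hm N
  have hMn : (bigM m N : ℝ) ≤ n := by exact_mod_cast hNn
  calc _ ≤ _ := h
    _ ≤ 2 * lam ^ 2 * ∑ s ∈ Finset.range (N + 1), (bigM m s : ℝ) * 3 := by
        gcongr with s
        exact hmean s
    _ ≤ 2 * lam ^ 2 * (6 * n) := by
        rw [← Finset.sum_mul, Finset.sum_range_succ]
        refine mul_le_mul_of_nonneg_left ?_ (by positivity)
        linarith
    _ = n * (12 * lam ^ 2) := by ring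

lemma conj_psi (hm : ∀ k, 2 ≤ m k) (n : ℕ) (x : Group m) : conj (psi m n x) = psi m n (-x) := by
  have h0 : psi m n 0 = 1 := by
    have h := psi_sub hm n x x
    rwa [sub_self, Complex.mul_conj, Complex.normSq_eq_norm_sq, norm_psi hm, one_pow,
      Complex.ofReal_one] at h
  have h := psi_sub hm n 0 x
  rw [zero_sub, h0, one_mul] at h
  exact h.symm

lemma enorm_fejer_sub_comm (hm : ∀ k, 2 ≤ m k) (n : ℕ) (x t : Group m) :
    ‖fejer m n (x - t)‖ₑ = ‖fejer m n (t - x)‖ₑ := by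
  have h : fejer m n (x - t) = conj (fejer m n (t - x)) := by
    simp only [fejer, dirichlet, map_sum, conj_psi hm, neg_sub]
  rw [h, RCLike.enorm_conj]

lemma fejerMean_eq_integral (hm : ∀ k, 2 ≤ m k) {f : Group m → ℂ} (hf : Integrable f (haar m))
    (n : ℕ) (x : Group m) : (n : ℂ)⁻¹ * ∑ k ∈ Finset.range n, partialSum m k f x =
      ∫ t, f t * ((n : ℂ)⁻¹ * fejer m n (x - t)) ∂(haar m) := by
  rw [sum_partialSum_eq_integral hm hf, ← integral_const_mul]
  congr 1
  ext t
  ring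

lemma continuous_partialSum (hm : ∀ k, 2 ≤ m k) (f : Group m → ℂ) (n : ℕ) :
    Continuous (partialSum m n f) :=
  continuous_finsetSum _ fun k _ => continuous_const.mul (continuous_psi hm k)

lemma partialSum_add (hm : ∀ k, 2 ≤ m k) {f g : Group m → ℂ} (hf : Integrable f (haar m))
    (hg : Integrable g (haar m)) (n : ℕ) (x : Group m) :
    partialSum m n (f + g) x = partialSum m n f x + partialSum m n g x := by
  have hc := continuous_dirichlet_sub hm n x
  rw [partialSum_eq_integral hm (hf.add hg), partialSum_eq_integral hm hf,
    partialSum_eq_integral hm hg, ← integral_add (integrable_mul_continuous hf hc)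
      (integrable_mul_continuous hg hc)]
  simp only [Pi.add_apply, add_mul]

/-- Fejér means converge in `L_p`: boundedly and pointwise for continuous functions, and in general
by density and the uniform bound of Schur's test. -/
lemma tendsto_eLpNorm_fejerMean_sub (hm : ∀ k, 2 ≤ m k) (hbdd : BddAbove (Set.range m))
    {p : ℝ≥0∞} (hp : 1 ≤ p) (hp' : p ≠ ∞) {f : Group m → ℂ} (hf : MemLp f p (haar m)) :
    Tendsto (fun n : ℕ => eLpNorm (fun x => (n : ℂ)⁻¹ * ∑ k ∈ Finset.range n, partialSum m k f x -
      f x) p (haar m)) atTop (𝓝 0) := by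
  have hp0 : p ≠ 0 := (zero_lt_one.trans_le hp).ne'
  obtain ⟨lam, hlam⟩ := id hbdd
  replace hlam (k : ℕ) : m k ≤ lam := hlam ⟨k, rfl⟩
  set C : ℝ≥0∞ := ENNReal.ofReal (12 * lam ^ 2) with hC
  have hCtop : C ≠ ∞ := ENNReal.ofReal_ne_top
  set σ : ℕ → (Group m → ℂ) → Group m → ℂ :=
    fun n f x => (n : ℂ)⁻¹ * ∑ k ∈ Finset.range n, partialSum m k f x with hσ
  have hσc (n : ℕ) (f : Group m → ℂ) : Continuous (σ n f) :=
    continuous_const.mul (continuous_finsetSum _ fun k _ => continuous_partialSum hm f k)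
  have hσle (n : ℕ) {h : Group m → ℂ} (hh : MemLp h p (haar m)) :
      eLpNorm (σ n h) p (haar m) ≤ C * eLpNorm h p (haar m) := by
    have hrow (x : Group m) := lintegral_enorm_fejer_le hm hlam n x
    have h1 : σ n h = fun x => ∫ t, h t * ((n : ℂ)⁻¹ * fejer m n (x - t)) ∂(haar m) :=
      funext fun x => fejerMean_eq_integral hm (hh.integrable hp) n x
    rw [h1]
    refine eLpNorm_integral_mul_le (K := fun x t => (n : ℂ)⁻¹ * fejer m n (x - t)) ?_ hCtop hrow
      (fun t => ?_) hp hp' hh.1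
    · exact (continuous_const.mul ((continuous_fejer hm n).comp
        (continuous_fst.sub continuous_snd))).measurable
    · simpa only [enorm_mul, enorm_fejer_sub_comm hm n _ t] using hrow t
  have hbc (g : BoundedContinuousFunction (Group m) ℂ) :
      Tendsto (fun n => eLpNorm (σ n g - ⇑g) p (haar m)) atTop (𝓝 0) := by
    have hgi : Integrable g (haar m) := integrable_continuous g.continuous
    have hgB (t : Group m) : ‖g t‖ₑ ≤ ENNReal.ofReal ‖g‖ := by
      rw [← ofReal_norm]
      exact ENNReal.ofReal_le_ofReal (g.norm_coe_le_norm t)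
    refine tendsto_eLpNorm_zero_of_bounded (B := ENNReal.ofReal ‖g‖ * C + ENNReal.ofReal ‖g‖)
      (fun n => ((hσc n g).sub g.continuous).aestronglyMeasurable) (by finiteness)
      (fun n x => ?_) (fun x => ?_) hp0 hp'
    · refine enorm_sub_le.trans (add_le_add ?_ (hgB x))
      simp only [hσ]
      rw [fejerMean_eq_integral hm hgi]
      refine (enorm_integral_le_lintegral_enorm _).trans ?_
      calc _ ≤ ∫⁻ t, ENNReal.ofReal ‖g‖ * ‖(n : ℂ)⁻¹ * fejer m n (x - t)‖ₑ ∂(haar m) := by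
            refine lintegral_mono fun t => ?_
            rw [enorm_mul]
            gcongr
            exact hgB t
        _ ≤ _ := by
            rw [lintegral_const_mul' _ _ ENNReal.ofReal_ne_top]
            gcongr
            exact lintegral_enorm_fejer_le hm hlam n x
    · have h := (isVilenkinLebesguePoint_of_continuousAt hm hgi
        g.continuous.continuousAt (x := x)).tendsto_fejer hm hbdd
      refine h.congr' ?_
      filter_upwards [eventually_gt_atTop 0] with n hn
      have hn' : (n : ℂ) ≠ 0 := by exact_mod_cast hn.ne'
      simp only [hσ, Pi.sub_apply, Finset.sum_sub_distrib, Finset.sum_const, Finset.card_range,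
        nsmul_eq_mul, Complex.real_smul]
      push_cast
      rw [mul_sub, inv_mul_cancel_left₀ hn']
  rw [ENNReal.tendsto_nhds_zero]
  intro ε hε
  -- `f - g` and its Fejér means contribute `C δ + δ`, the continuous function `g` the rest.
  obtain ⟨δ, hδ, hδε⟩ : ∃ δ : ℝ≥0∞, δ ≠ 0 ∧ (C + 1) * δ ≤ ε / 2 := by
    refine ⟨(ε / 2) / (C + 1), ENNReal.div_ne_zero.2 ⟨(ENNReal.half_pos hε.ne').ne',
      by finiteness⟩, ENNReal.mul_div_le⟩
  obtain ⟨g, hfg, hg⟩ := hf.exists_boundedContinuous_eLpNorm_sub_le hp' hδ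
  filter_upwards [(ENNReal.tendsto_nhds_zero.1 (hbc g)) (ε / 2) (ENNReal.half_pos hε.ne')] with n hn
  have hfgm : MemLp (f - ⇑g) p (haar m) := hf.sub hg
  have hdecomp : (fun x => σ n f x - f x) = σ n (f - ⇑g) + ((σ n g - ⇑g) + (⇑g - f)) := by
    ext x
    have h1 : σ n f x = σ n (f - ⇑g) x + σ n g x := by
      simp only [hσ]
      rw [← mul_add, ← Finset.sum_add_distrib]
      congr 1
      refine Finset.sum_congr rfl fun k _ => ?_
      rw [← partialSum_add hm (hfgm.integrable hp) (hg.integrable hp), sub_add_cancel]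
    simp only [Pi.add_apply, Pi.sub_apply, h1]
    ring
  have hm1 : AEStronglyMeasurable (σ n (f - ⇑g)) (haar m) := (hσc n _).aestronglyMeasurable
  have hm2 : AEStronglyMeasurable (σ n g - ⇑g) (haar m) :=
    ((hσc n _).sub g.continuous).aestronglyMeasurable
  have hm3 : AEStronglyMeasurable (⇑g - f) (haar m) := (hg.sub hf).1
  rw [hdecomp]
  calc _ ≤ eLpNorm (σ n (f - ⇑g)) p (haar m) +
        (eLpNorm (σ n g - ⇑g) p (haar m) + eLpNorm (⇑g - f) p (haar m)) :=
        (eLpNorm_add_le hm1 (hm2.add hm3) hp).trans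
          (add_le_add_right (eLpNorm_add_le hm2 hm3 hp) _)
    _ ≤ C * δ + (ε / 2 + δ) := by
        gcongr
        · exact (hσle n hfgm).trans (by gcongr)
        · rw [eLpNorm_sub_comm]
          exact hfg
    _ = (C + 1) * δ + ε / 2 := by ring
    _ ≤ ε / 2 + ε / 2 := by gcongr
    _ = ε := ENNReal.add_halves ε

lemma toLp_sum_smul {α : Type*} [MeasurableSpace α] {μ : Measure α} {p : ℝ≥0∞}
    {u : ℕ → α → ℂ} (hu : ∀ k, MemLp (u k) p μ) (w : ℕ → ℝ) (s : Finset ℕ) :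
    ∑ k ∈ s, w k • (hu k).toLp (u k) =
      (memLp_finsetSum' s fun k _ => (hu k).const_smul (w k)).toLp (∑ k ∈ s, w k • u k) := by
  induction s using Finset.cons_induction with
  | empty => simp
  | cons a s ha ih =>
    simp only [Finset.sum_cons, ih]
    rfl

/-! ### The `T` means -/

lemma tMean_sub_eq {q : ℕ → ℝ} {n : ℕ} (hQ : bigQ q n ≠ 0) (f : Group m → ℂ) (x : Group m) :
    tMean m q n f x - f x =
      (bigQ q n)⁻¹ • ∑ k ∈ Finset.range n, q k • (partialSum m k f x - f x) := by
  have hQ' : (bigQ q n : ℂ) ≠ 0 := by exact_mod_cast hQ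
  have hsum : (bigQ q n : ℂ) = ∑ k ∈ Finset.range n, (q k : ℂ) := by simp [bigQ]
  simp only [tMean, Complex.real_smul, mul_sub, Finset.sum_sub_distrib, ← Finset.sum_mul, ← hsum]
  push_cast
  rw [inv_mul_cancel_left₀ hQ', one_div]

lemma IsVilenkinLebesguePoint.tendsto_tMean (hm : ∀ k, 2 ≤ m k) (hbdd : BddAbove (Set.range m))
    {q : ℕ → ℝ} (hq : ∀ k, 0 ≤ q k) (hq0 : 0 < q 0)
    (hmono : (Antitone q ∧ Tendsto (bigQ q) atTop atTop) ∨
      (Monotone q ∧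
        (fun n : ℕ => q (n - 1) / bigQ q n) =O[atTop] (fun n : ℕ => 1 / (n : ℝ))))
    {f : Group m → ℂ} {x : Group m} (h : IsVilenkinLebesguePoint m f x) :
    Tendsto (fun n => tMean m q n f x) atTop (𝓝 (f x)) := by
  rw [← tendsto_sub_nhds_zero_iff]
  refine (tendsto_weighted_mean_zero hq hq0 hmono (h.tendsto_fejer hm hbdd)).congr' ?_
  filter_upwards [(weights_bound hq hq0 hmono).1.eventually_gt_atTop 0] with n hn
  exact (tMean_sub_eq hn.ne' f x).symm

lemma tendsto_eLpNorm_tMean_sub (hm : ∀ k, 2 ≤ m k) (hbdd : BddAbove (Set.range m))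
    {q : ℕ → ℝ} (hq : ∀ k, 0 ≤ q k) (hq0 : 0 < q 0)
    (hmono : (Antitone q ∧ Tendsto (bigQ q) atTop atTop) ∨
      (Monotone q ∧
        (fun n : ℕ => q (n - 1) / bigQ q n) =O[atTop] (fun n : ℕ => 1 / (n : ℝ))))
    {p : ℝ≥0∞} (hp : 1 ≤ p) (hp' : p ≠ ∞) {f : Group m → ℂ} (hf : MemLp f p (haar m)) :
    Tendsto (fun n => eLpNorm (fun x => tMean m q n f x - f x) p (haar m)) atTop (𝓝 0) := by
  have : Fact (1 ≤ p) := ⟨hp⟩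
  have hu (k : ℕ) : MemLp (partialSum m k f - f) p (haar m) := by
    refine MemLp.sub ?_ hf
    obtain ⟨B, hB⟩ :=
      isCompact_univ.exists_bound_of_continuousOn (continuous_partialSum hm f k).continuousOn
    exact MemLp.of_bound (continuous_partialSum hm f k).aestronglyMeasurable B
      (Eventually.of_forall fun x => hB x trivial)
  have key (c : ℝ) (w : ℕ → ℝ) (n : ℕ) :
      ‖c • ∑ k ∈ Finset.range n, w k • (hu k).toLp (partialSum m k f - f)‖ₑ =
        eLpNorm (c • ∑ k ∈ Finset.range n, w k • (partialSum m k f - f)) p (haar m) := by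
    rw [toLp_sum_smul, ← MemLp.toLp_const_smul, Lp.enorm_toLp]
  have hfejer : Tendsto (fun n : ℕ => (n : ℝ)⁻¹ • ∑ k ∈ Finset.range n,
      (hu k).toLp (partialSum m k f - f)) atTop (𝓝 0) := by
    rw [tendsto_zero_iff_enorm_tendsto_zero]
    refine (tendsto_eLpNorm_fejerMean_sub hm hbdd hp hp' hf).congr' ?_
    filter_upwards [eventually_gt_atTop 0] with n hn
    have hn' : (n : ℂ) ≠ 0 := by exact_mod_cast hn.ne'
    have h := key (n : ℝ)⁻¹ (fun _ => 1) n
    simp only [one_smul] at h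
    rw [h]
    congr 1
    ext x
    simp only [Pi.smul_apply, Finset.sum_apply, Pi.sub_apply, Finset.sum_sub_distrib,
      Finset.sum_const, Finset.card_range, nsmul_eq_mul, Pi.mul_apply, Pi.natCast_apply,
      Complex.real_smul]
    push_cast
    rw [mul_sub, inv_mul_cancel_left₀ hn']
  have hT := tendsto_weighted_mean_zero hq hq0 hmono hfejer
  rw [tendsto_zero_iff_enorm_tendsto_zero] at hT
  refine hT.congr' ?_
  filter_upwards [(weights_bound hq hq0 hmono).1.eventually_gt_atTop 0] with n hn
  rw [key]
  congr 1
  ext x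
  rw [tMean_sub_eq hn.ne']
  simp only [Pi.smul_apply, Finset.sum_apply, Pi.sub_apply]

end Vilenkin

end

theorem mainTheorem1
    (m : ℕ → ℕ) [∀ k, NeZero (m k)] (hm : ∀ k, 2 ≤ m k) (hbdd : BddAbove (Set.range m))
    (q : ℕ → ℝ) (hq : ∀ k, 0 ≤ q k) (hq0 : 0 < q 0)
    (hmono : (Antitone q ∧ Tendsto (Vilenkin.bigQ q) atTop atTop) ∨
      (Monotone q ∧
        (fun n : ℕ => q (n - 1) / Vilenkin.bigQ q n) =O[atTop] (fun n : ℕ => 1 / (n : ℝ)))) :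
    (∀ p : ℝ≥0∞, 1 ≤ p → p ≠ ∞ → ∀ f : Vilenkin.Group m → ℂ, MemLp f p (Vilenkin.haar m) →
      Tendsto (fun n => eLpNorm (fun x => Vilenkin.tMean m q n f x - f x) p (Vilenkin.haar m))
        atTop (𝓝 0)) ∧
    (∀ f : Vilenkin.Group m → ℂ, Integrable f (Vilenkin.haar m) →
      ∀ x : Vilenkin.Group m, ContinuousAt f x →
        Tendsto (fun n => Vilenkin.tMean m q n f x) atTop (𝓝 (f x))) ∧
    (∀ p : ℝ≥0∞, 1 ≤ p → p ≠ ∞ → ∀ f : Vilenkin.Group m → ℂ, MemLp f p (Vilenkin.haar m) →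
      ∀ x : Vilenkin.Group m, Vilenkin.IsVilenkinLebesguePoint m f x →
        Tendsto (fun n => Vilenkin.tMean m q n f x) atTop (𝓝 (f x))) := by
  refine ⟨fun p hp hp' f hf => Vilenkin.tendsto_eLpNorm_tMean_sub hm hbdd hq hq0 hmono hp hp' hf,
    fun f hf x hx => ?_, fun p _ _ f _ x hx => hx.tendsto_tMean hm hbdd hq hq0 hmono⟩
  exact (Vilenkin.isVilenkinLebesguePoint_of_continuousAt hm hf hx).tendsto_tMean hm hbdd hq hq0 hmono
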